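/- Let $\mathcal F^2(\mathbb C)$ be the Fock space of entire functions that are square integrable with respect to the Gaussian measure $d\mathrm g(z)=\frac1\pi e^{-|z|^2}\,d\nu(z)$ ($\nu$ is Lebesgue measure on $\mathbb C$), regarded as a closed subspace of $L_2(\mathbb C,d\mathrm g)$; let $\mathrm P$ be the orthogonal projection of $L_2(\mathbb C,d\mathrm g)$ onto it, and let $e_n(z)=z^n/\sqrt{n!}$, $n\in\mathbb Z_+=\{0,1,2,\dots\}$. For $\varphi\in L_\infty(\mathbb C)$ let $T_\varphi f=\mathrm P(\varphi f)$ be the Toeplitz operator on $\mathcal F^2(\mathbb C)$ with symbol $\varphi$. The symbol $\varphi$ is called radial if there is $a\in L_\infty(\mathbb R_+)$ with $\varphi(z)=a(|z|)$ for a.e. $z\in\mathbb C$. Let $\mathcal T_{\mathrm{rad}}$ be the C*-algebra generated by all $T_\varphi$ with radial $\varphi\in L_\infty(\mathbb C)$. For $a\in L_\infty(\mathbb R_+)$ put $$\gamma_a(n)=\frac1{n!}\int_0^\infty a(\sqrt r\,)\,e^{-r}r^n\,dr,\qquad n\in\mathbb Z_+,$$ let $\mathfrak G=\{\gamma_a\colon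 a\in L_\infty(\mathbb R_+)\}\subseteq\ell_\infty(\mathbb Z_+)$, and let $\mathcal G$ be the C*-subalgebra of $\ell_\infty(\mathbb Z_+)$ generated by $\mathfrak G$. Let $\mathrm{RO}(\mathbb Z_+)$ be the C*-algebra of all bounded sequences $\sigma\colon\mathbb Z_+\to\mathbb C$ that are uniformly continuous with respect to the metric $\rho(m,n)=|\sqrt m-\sqrt n|$, i.e. such that $$\lim_{\delta\to0^+}\ \sup\{|\sigma_n-\sigma_m|\colon m,n\in\mathbb Z_+,\ \rho(m,n)\le\delta\}=0 .$$ Theorem. (1) If $a\in L_\infty(\mathbb R_+)$, $\varphi\in L_\infty(\mathbb C)$ and $\varphi(z)=a(|z|)$ for a.e. $z\in\mathbb C$, then $T_\varphi e_n=\gamma_a(n)e_n$ for every $n\in\mathbb Z_+$. (2) $\mathfrak G\subseteq\mathrm{RO}(\mathbb Z_+)$, and $\mathfrak G$ is uniformly dense in $\mathrm{RO}(\mathbb Z_+)$: for every $\sigma\in\mathrm{RO}(\mathbb Z_+)$ and $\varepsilon>0$ there is $a\in L_\infty(\mathbb R_+)$ with $\|\sigma-\gamma_a\|_\infty\le\varepsilon$.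 Thus the closure of $\mathfrak G$ in $\ell_\infty(\mathbb Z_+)$ is $\mathrm{RO}(\mathbb Z_+)$. (3) $\mathcal G=\mathrm{RO}(\mathbb Z_+)$. (4) There is an isometric $*$-isomorphism $\Phi$ of $\mathcal T_{\mathrm{rad}}$ onto $\mathrm{RO}(\mathbb Z_+)$ such that $Se_n=\Phi(S)(n)\,e_n$ for all $S\in\mathcal T_{\mathrm{rad}}$ and $n\in\mathbb Z_+$. -/

import Mathlib

open MeasureTheory Filter Topology
open scoped ENNReal

noncomputable section

namespace RadialFock

/-! ### The Fock space -/

/-- The Gaussian measure `dg(z) = π⁻¹ exp (-|z|²) dν(z)` on `ℂ`, `ν` being Lebesgue measure. -/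
def gaussian : Measure ℂ :=
  (volume : Measure ℂ).withDensity
    (fun z => ENNReal.ofReal (Real.pi⁻¹ * Real.exp (-‖z‖ ^ 2)))

theorem measurable_gaussianDensity :
    Measurable (fun z : ℂ => ENNReal.ofReal (Real.pi⁻¹ * Real.exp (-‖z‖ ^ 2))) := by
  fun_prop

theorem gaussian_absolutelyContinuous : gaussian ≪ (volume : Measure ℂ) :=
  withDensity_absolutelyContinuous _ _

theorem integrable_pow_mul_exp (n : ℕ) :
    Integrable (fun z : ℂ => ‖z‖ ^ n * Real.exp (-‖z‖ ^ 2)) := by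
  have h := Complex.integral_rpow_mul_exp_neg_rpow (p := 2) (q := (n : ℝ)) (by norm_num)
    (by have : (0 : ℝ) ≤ n := n.cast_nonneg
        linarith)
  have h2 : (∫ x : ℂ, ‖x‖ ^ (n : ℝ) * Real.exp (-‖x‖ ^ (2 : ℝ))) ≠ 0 := by
    rw [h]
    have : 0 < Real.Gamma (((n : ℝ) + 2) / 2) := Real.Gamma_pos_of_pos (by positivity)
    positivity
  have h3 := not_imp_comm.1 integral_undef h2
  refine h3.congr (ae_of_all _ fun z => ?_)
  simp only [Real.rpow_natCast, Real.rpow_two]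

instance : IsFiniteMeasure gaussian := by
  refine isFiniteMeasure_withDensity_ofReal ?_
  have := (integrable_pow_mul_exp 0).const_mul Real.pi⁻¹
  simpa using this.2

/-- The subspace of `L²(ℂ, dg)` of the classes of square integrable entire functions. -/
def fockSubmodule : Submodule ℂ (Lp ℂ 2 gaussian) where
  carrier := {f | ∃ F : ℂ → ℂ, Differentiable ℂ F ∧ f =ᵐ[gaussian] F}
  add_mem' := by
    rintro f g ⟨F, hF, hf⟩ ⟨G, hG, hg⟩
    exact ⟨F + G, hF.add hG, (Lp.coeFn_add f g).trans (hf.add hg)⟩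
  zero_mem' := ⟨0, differentiable_const 0, Lp.coeFn_zero ..⟩
  smul_mem' := by
    rintro c f ⟨F, hF, hf⟩
    exact ⟨c • F, hF.const_smul c, (Lp.coeFn_smul c f).trans (hf.const_smul c)⟩

/-- An area form of the mean value inequality for entire functions. -/
theorem enorm_le_lintegral_ball {F : ℂ → ℂ} (hF : Differentiable ℂ F) (w : ℂ) :
    ‖F w‖ₑ ≤ ∫⁻ z in Metric.ball w 1, ‖F z‖ₑ := by
  have hc : Continuous F := hF.continuous
  have h1 : ∫⁻ z in Metric.ball w 1, ‖F z‖ₑ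
      = ∫⁻ z in Metric.ball (0 : ℂ) 1, ‖F (w + z)‖ₑ := by
    rw [← lintegral_indicator measurableSet_ball, ← lintegral_indicator measurableSet_ball,
      ← lintegral_add_left_eq_self _ w]
    refine lintegral_congr fun z => ?_
    simp [Set.indicator, Metric.mem_ball, dist_eq_norm]
  rw [h1, ← lintegral_indicator measurableSet_ball, ← Complex.lintegral_comp_polarCoord_symm]
  have hcirc : ∀ r : ℝ, 0 < r → ENNReal.ofReal (2 * Real.pi) * ‖F w‖ₑ
      ≤ ∫⁻ θ in Set.Ioo (-Real.pi) Real.pi, ‖F (w + Complex.polarCoord.symm (r, θ))‖ₑ := by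
    intro r hr
    have hm : Real.circleAverage F w r = F w :=
      (hF.diffContOnCl).circleAverage
    have hpi : (-Real.pi : ℝ) ≤ Real.pi := by linarith [Real.pi_pos]
    have hper : Function.Periodic (fun θ => F (circleMap w r θ)) (2 * Real.pi) :=
      fun θ => by simp only [periodic_circleMap w r θ]
    have hI : ∫ θ in (-Real.pi)..Real.pi, F (circleMap w r θ) = (2 * Real.pi) • F w := by
      have h3 := hper.intervalIntegral_add_eq (-Real.pi) 0
      have h4 : -Real.pi + 2 * Real.pi = Real.pi := by ring
      rw [h4, zero_add] at h3
      rw [h3, ← hm, Real.circleAverage_def, smul_smul,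
        mul_inv_cancel₀ (by positivity), one_smul]
    have h5 : ‖∫ θ in Set.Ioo (-Real.pi) Real.pi, F (circleMap w r θ)‖ₑ
        = ENNReal.ofReal (2 * Real.pi) * ‖F w‖ₑ := by
      rw [← integral_Ioc_eq_integral_Ioo, ← intervalIntegral.integral_of_le hpi, hI, enorm_smul,
        Real.enorm_eq_ofReal (by positivity)]
    rw [← h5]
    refine (enorm_integral_le_lintegral_enorm _).trans_eq (lintegral_congr fun θ => ?_)
    simp [circleMap, Complex.polarCoord_symm_apply, Complex.exp_mul_I]
  have hmeas : Measurable fun p : ℝ × ℝ =>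
      ENNReal.ofReal p.1 * ‖F (w + Complex.polarCoord.symm p)‖ₑ := by
    have h6 : Continuous fun p : ℝ × ℝ => F (w + Complex.polarCoord.symm p) := by
      simp only [Complex.polarCoord_symm_apply]
      fun_prop
    exact (ENNReal.measurable_ofReal.comp measurable_fst).mul h6.measurable.enorm
  have hint : Integrable (fun x : ℝ => x) ((volume : Measure ℝ).restrict (Set.Ioo (0 : ℝ) 1)) :=
    (continuous_id.integrableOn_Icc).mono_set Set.Ioo_subset_Icc_self
  have hnn : 0 ≤ᵐ[(volume : Measure ℝ).restrict (Set.Ioo (0 : ℝ) 1)] fun x : ℝ => x :=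
    (ae_restrict_iff' measurableSet_Ioo).2 (ae_of_all _ fun x hx => hx.1.le)
  calc ‖F w‖ₑ
      ≤ ∫⁻ r in Set.Ioo (0 : ℝ) 1,
          ENNReal.ofReal r * (ENNReal.ofReal (2 * Real.pi) * ‖F w‖ₑ) := by
        rw [lintegral_mul_const _ ENNReal.measurable_ofReal,
          ← ofReal_integral_eq_lintegral_ofReal hint hnn,
          ← integral_Ioc_eq_integral_Ioo, ← intervalIntegral.integral_of_le zero_le_one,
          integral_id, ← mul_assoc, ← ENNReal.ofReal_mul (by norm_num)]
        refine le_mul_of_one_le_left (zero_le) ?_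
        rw [ENNReal.one_le_ofReal]
        nlinarith [Real.pi_gt_three]
    _ ≤ ∫⁻ r in Set.Ioo (0 : ℝ) 1, ∫⁻ θ in Set.Ioo (-Real.pi) Real.pi,
          ENNReal.ofReal r * ‖F (w + Complex.polarCoord.symm (r, θ))‖ₑ := by
        refine setLIntegral_mono' measurableSet_Ioo fun r hr => ?_
        rw [lintegral_const_mul']
        · exact mul_le_mul_right (hcirc r hr.1) _
        · exact ENNReal.ofReal_ne_top
    _ = ∫⁻ p in Set.Ioo (0 : ℝ) 1 ×ˢ Set.Ioo (-Real.pi) Real.pi,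
          ENNReal.ofReal p.1 * ‖F (w + Complex.polarCoord.symm p)‖ₑ := by
        rw [Measure.volume_eq_prod, ← Measure.prod_restrict, lintegral_prod _ hmeas.aemeasurable]
    _ ≤ _ := by
        rw [← lintegral_indicator (measurableSet_Ioo.prod measurableSet_Ioo),
          ← lintegral_indicator polarCoord.open_target.measurableSet]
        refine lintegral_mono fun p => ?_
        by_cases hp : p ∈ Set.Ioo (0 : ℝ) 1 ×ˢ Set.Ioo (-Real.pi) Real.pi
        · obtain ⟨hp1, hp2⟩ := hp
          have h7 : p ∈ polarCoord.target := ⟨hp1.1, hp2⟩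
          have h8 : Complex.polarCoord.symm p ∈ Metric.ball (0 : ℂ) 1 := by
            rw [mem_ball_zero_iff, Complex.norm_polarCoord_symm, abs_of_pos hp1.1]
            exact hp1.2
          rw [Set.indicator_of_mem (show p ∈ Set.Ioo (0 : ℝ) 1 ×ˢ _ from ⟨hp1, hp2⟩),
            Set.indicator_of_mem h7, Set.indicator_of_mem h8, smul_eq_mul]
        · rw [Set.indicator_of_notMem hp]
          exact zero_le

/-- Point evaluations are bounded on the Fock space, locally uniformly. -/
theorem exists_enorm_le (R : ℝ) : ∃ C : ℝ≥0∞, C ≠ ∞ ∧ ∀ F : ℂ → ℂ, Differentiable ℂ F →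
    ∀ w : ℂ, ‖w‖ ≤ R → ‖F w‖ₑ ≤ C * eLpNorm F 2 gaussian := by
  set K : ℝ≥0∞ := ENNReal.ofReal (Real.pi * Real.exp ((R + 1) ^ 2)) with hK
  refine ⟨K * gaussian Set.univ ^ (1 / (1 : ℝ) - 1 / 2), ?_, fun F hF w hw => ?_⟩
  · refine ENNReal.mul_ne_top ENNReal.ofReal_ne_top (ENNReal.rpow_ne_top_of_nonneg (by norm_num) ?_)
    exact measure_ne_top _ _
  have hm : AEStronglyMeasurable F gaussian := hF.continuous.aestronglyMeasurable
  have h1 : eLpNorm F 1 gaussian ≤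
      eLpNorm F 2 gaussian * gaussian Set.univ ^ (1 / (1 : ℝ) - 1 / 2) := by
    have := eLpNorm_le_eLpNorm_mul_rpow_measure_univ (p := 1) (q := 2) (μ := gaussian)
      (by norm_num) hm
    simpa using this
  calc ‖F w‖ₑ ≤ ∫⁻ z in Metric.ball w 1, ‖F z‖ₑ := enorm_le_lintegral_ball hF w
    _ ≤ ∫⁻ z in Metric.ball w 1,
          K * (ENNReal.ofReal (Real.pi⁻¹ * Real.exp (-‖z‖ ^ 2)) * ‖F z‖ₑ) := by
        refine setLIntegral_mono' measurableSet_ball fun z hz => ?_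
        rw [← mul_assoc, hK, ← ENNReal.ofReal_mul (by positivity)]
        refine le_mul_of_one_le_left zero_le ?_
        rw [ENNReal.one_le_ofReal]
        have hz' : ‖z‖ ≤ R + 1 := by
          have h2 : ‖z - w‖ < 1 := by simpa [dist_eq_norm] using hz
          have h3 := norm_le_norm_add_norm_sub' z w
          linarith
        have h4 : Real.pi * Real.exp ((R + 1) ^ 2) * (Real.pi⁻¹ * Real.exp (-‖z‖ ^ 2))
            = Real.exp ((R + 1) ^ 2 - ‖z‖ ^ 2) := by
          rw [sub_eq_add_neg, Real.exp_add]
          field_simp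
        rw [h4, Real.one_le_exp_iff]
        nlinarith [norm_nonneg z]
    _ ≤ ∫⁻ z, K * (ENNReal.ofReal (Real.pi⁻¹ * Real.exp (-‖z‖ ^ 2)) * ‖F z‖ₑ) :=
        setLIntegral_le_lintegral _ _
    _ = K * eLpNorm F 1 gaussian := by
        rw [lintegral_const_mul' _ _ ENNReal.ofReal_ne_top, eLpNorm_one_eq_lintegral_enorm, gaussian,
          lintegral_withDensity_eq_lintegral_mul _ measurable_gaussianDensity
            hF.continuous.measurable.enorm]
        rfl
    _ ≤ K * (eLpNorm F 2 gaussian * gaussian Set.univ ^ (1 / (1 : ℝ) - 1 / 2)) := by gcongr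
    _ = _ := by ring

theorem isClosed_fockSubmodule : IsClosed (fockSubmodule : Set (Lp ℂ 2 gaussian)) := by
  refine IsSeqClosed.isClosed fun f g hf hfg => ?_
  choose F hF hfF using hf
  have hcau : CauchySeq f := hfg.cauchySeq
  have hdist : ∀ R : ℝ, ∃ C : ℝ, 0 ≤ C ∧ ∀ m n, ∀ w : ℂ, ‖w‖ ≤ R →
      dist (F m w) (F n w) ≤ C * dist (f m) (f n) := by
    intro R
    obtain ⟨C, hC, h⟩ := exists_enorm_le R
    refine ⟨C.toReal, ENNReal.toReal_nonneg, fun m n w hw => ?_⟩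
    have h1 := h (F m - F n) ((hF m).sub (hF n)) w hw
    have h2 : eLpNorm (F m - F n) 2 gaussian = edist (f m) (f n) := by
      rw [Lp.edist_def]
      exact eLpNorm_congr_ae ((hfF m).sub (hfF n)).symm
    rw [h2] at h1
    rw [← ENNReal.ofReal_le_ofReal_iff (by positivity), ENNReal.ofReal_mul ENNReal.toReal_nonneg,
      ENNReal.ofReal_toReal hC, ← edist_dist, ← edist_dist, edist_eq_enorm_sub]
    exact h1
  have hunif : ∀ R : ℝ, UniformCauchySeqOn F atTop (Metric.closedBall 0 R) := by
    intro R
    obtain ⟨C, hC0, hC⟩ := hdist R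
    rw [Metric.uniformCauchySeqOn_iff]
    intro ε hε
    obtain ⟨N, hN⟩ := Metric.cauchySeq_iff.1 hcau (ε / (C + 1)) (by positivity)
    refine ⟨N, fun m hm n hn w hw => ?_⟩
    have h1 := hC m n w (by simpa using hw)
    have h2 := hN m hm n hn
    rw [lt_div_iff₀ (by positivity)] at h2
    nlinarith [dist_nonneg (x := f m) (y := f n)]
  have hlim : ∀ w, ∃ y, Tendsto (fun n => F n w) atTop (𝓝 y) := fun w =>
    cauchySeq_tendsto_of_complete ((hunif ‖w‖).cauchySeq (by simp))
  choose G hG using hlim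
  have hloc : TendstoLocallyUniformlyOn F G atTop Set.univ := by
    rw [tendstoLocallyUniformlyOn_univ, tendstoLocallyUniformly_iff_forall_isCompact]
    intro k hk
    obtain ⟨R, hR⟩ := hk.isBounded.subset_closedBall 0
    exact ((hunif R).tendstoUniformlyOn_of_tendsto fun w _ => hG w).mono hR
  have hGd : Differentiable ℂ G := by
    rw [← differentiableOn_univ]
    exact hloc.differentiableOn (Eventually.of_forall fun n => (hF n).differentiableOn) isOpen_univ
  refine ⟨G, hGd, ?_⟩
  obtain ⟨ns, hns, hae⟩ := (tendstoInMeasure_of_tendsto_Lp hfg).exists_seq_tendsto_ae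
  filter_upwards [hae, ae_all_iff.2 hfF] with z hz hz'
  refine tendsto_nhds_unique hz ?_
  simp only [hz']
  exact (hG z).comp hns.tendsto_atTop

instance : CompleteSpace fockSubmodule := isClosed_fockSubmodule.completeSpace_coe

/-- The Fock space `F²(ℂ)`, with the Hilbert space structure inherited from `L²(ℂ, dg)`. -/
def FockSpace : Type := fockSubmodule

instance : NormedAddCommGroup FockSpace := inferInstanceAs (NormedAddCommGroup fockSubmodule)

instance : InnerProductSpace ℂ FockSpace := inferInstanceAs (InnerProductSpace ℂ fockSubmodule)

instance : CompleteSpace FockSpace := inferInstanceAs (CompleteSpace fockSubmodule)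

/-- The inclusion of the Fock space into `L²(ℂ, dg)`. -/
def fockInclusion : FockSpace →L[ℂ] Lp ℂ 2 gaussian := fockSubmodule.subtypeL

/-- The Bargmann projection: the orthogonal projection of `L²(ℂ, dg)` onto the Fock space. -/
def bargmannProjection : Lp ℂ 2 gaussian →L[ℂ] FockSpace := fockSubmodule.orthogonalProjectionOnto

theorem memLp_monomial (n : ℕ) :
    MemLp (fun z : ℂ => z ^ n / (Real.sqrt (n.factorial) : ℂ)) 2 gaussian := by
  have hc : Continuous (fun z : ℂ => z ^ n) := by fun_prop
  have h : MemLp (fun z : ℂ => z ^ n) 2 gaussian := by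
    rw [memLp_two_iff_integrable_sq_norm hc.aestronglyMeasurable, gaussian,
      integrable_withDensity_iff measurable_gaussianDensity (ae_of_all _ fun _ => by simp)]
    refine ((integrable_pow_mul_exp (2 * n)).const_mul Real.pi⁻¹).congr (ae_of_all _ fun z => ?_)
    simp only [norm_pow]
    rw [ENNReal.toReal_ofReal (by positivity)]
    ring
  simpa [div_eq_inv_mul] using h.const_mul ((Real.sqrt (n.factorial) : ℂ)⁻¹)

/-- The normalized monomial `eₙ(z) = zⁿ / √(n!)`, as an element of the Fock space. -/
def monomial (n : ℕ) : FockSpace :=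
  ⟨(memLp_monomial n).toLp, _, by fun_prop, (memLp_monomial n).coeFn_toLp⟩

/-! ### Toeplitz operators -/

/-- `L_∞(ℂ)`, with respect to Lebesgue measure. -/
abbrev LinftyC : Type := Lp ℂ ∞ (volume : Measure ℂ)

/-- `L_∞(ℝ₊)`, with respect to Lebesgue measure. -/
abbrev LinftyPos : Type := Lp ℂ ∞ ((volume : Measure ℝ).restrict (Set.Ioi 0))

theorem memLp_symbol (φ : LinftyC) : MemLp φ ∞ gaussian :=
  ⟨(Lp.aestronglyMeasurable φ).mono_ac gaussian_absolutelyContinuous, by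
    have h := (Lp.memLp φ).2
    rw [eLpNorm_exponent_top] at h ⊢
    exact (eLpNormEssSup_mono_measure _ gaussian_absolutelyContinuous).trans_lt h⟩

/-- The operator of multiplication by `φ ∈ L_∞(ℂ)` on `L²(ℂ, dg)`. -/
def multiplication (φ : LinftyC) : Lp ℂ 2 gaussian →L[ℂ] Lp ℂ 2 gaussian :=
  (ContinuousLinearMap.mul ℂ ℂ).holderL gaussian ∞ 2 2 (memLp_symbol φ).toLp

theorem multiplication_apply_ae (φ : LinftyC) (f : Lp ℂ 2 gaussian) :
    multiplication φ f =ᵐ[gaussian] fun z => φ z * f z := by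
  refine ((ContinuousLinearMap.mul ℂ ℂ).coeFn_holder (r := 2) (memLp_symbol φ).toLp f).trans ?_
  filter_upwards [(memLp_symbol φ).coeFn_toLp] with z hz
  simp [hz]

/-- The Toeplitz operator `T_φ f = P (φ f)` on the Fock space, `P` being the Bargmann
projection. -/
def toeplitz (φ : LinftyC) : FockSpace →L[ℂ] FockSpace :=
  bargmannProjection ∘L multiplication φ ∘L fockInclusion

/-- `φ(z) = a(|z|)` for almost every `z ∈ ℂ`. -/
def HasRadialProfile (φ : LinftyC) (a : LinftyPos) : Prop :=
  ∀ᵐ z : ℂ, φ z = a ‖z‖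

/-- `φ ∈ L_∞(ℂ)` is radial. -/
def IsRadialSymbol (φ : LinftyC) : Prop :=
  ∃ a : LinftyPos, HasRadialProfile φ a

/-- The C*-algebra generated by the Toeplitz operators with radial symbols: the norm closure, in
the bounded operators on the Fock space, of the *-algebra generated by them (the identity is
the Toeplitz operator with symbol `1`, so that the unital algebra is the same). -/
def radialToeplitzAlgebra : StarSubalgebra ℂ (FockSpace →L[ℂ] FockSpace) :=
  (StarAlgebra.adjoin ℂ {T | ∃ φ, IsRadialSymbol φ ∧ toeplitz φ = T}).topologicalClosure

/-! ### Bounded sequences and the eigenvalue sequences -/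

/-- `ℓ_∞(ℤ₊)`. -/
abbrev LinftySeq : Type := lp (fun _ : ℕ => ℂ) ∞

/-- `γ_a(n) = (1/n!) ∫₀^∞ a(√r) e^{-r} rⁿ dr`. -/
def gammaFun (a : LinftyPos) (n : ℕ) : ℂ :=
  (1 / (n.factorial : ℂ)) * ∫ r in Set.Ioi (0 : ℝ), a (Real.sqrt r) * (Real.exp (-r) * r ^ n : ℝ)

theorem ae_norm_comp_sqrt_le (a : LinftyPos) :
    ∀ᵐ r ∂(volume : Measure ℝ).restrict (Set.Ioi 0), ‖a (Real.sqrt r)‖ ≤ ‖a‖ := by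
  have h : ∀ᵐ x ∂(volume : Measure ℝ).restrict (Set.Ioi 0), ‖a x‖ ≤ ‖a‖ := by
    have h1 := ae_le_eLpNormEssSup (f := a) (μ := (volume : Measure ℝ).restrict (Set.Ioi 0))
    filter_upwards [h1] with x hx
    rw [Lp.norm_def, eLpNorm_exponent_top]
    have h2 : eLpNormEssSup a ((volume : Measure ℝ).restrict (Set.Ioi 0)) ≠ ∞ := by
      have := (Lp.memLp a).2
      rw [eLpNorm_exponent_top] at this
      exact this.ne
    simpa using ENNReal.toReal_mono h2 hx
  rw [ae_restrict_iff' measurableSet_Ioi, ae_iff] at h ⊢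
  have h3 := addHaar_image_eq_zero_of_differentiableOn_of_addHaar_eq_zero (f := fun x : ℝ => x ^ 2)
    volume (by fun_prop) h
  refine measure_mono_null (fun r hr => ?_) h3
  simp only [Set.mem_ofPred_eq, Classical.not_imp, Set.mem_Ioi] at hr
  refine ⟨Real.sqrt r, ?_, Real.sq_sqrt hr.1.le⟩
  simp only [Set.mem_ofPred_eq, Classical.not_imp, Set.mem_Ioi]
  exact ⟨Real.sqrt_pos.2 hr.1, hr.2⟩

theorem norm_gammaFun_le (a : LinftyPos) (n : ℕ) : ‖gammaFun a n‖ ≤ ‖a‖ := by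
  have hG := Real.Gamma_nat_eq_factorial n
  rw [Real.Gamma_eq_integral (by positivity)] at hG
  have hint : IntegrableOn (fun r : ℝ => Real.exp (-r) * r ^ n) (Set.Ioi 0) := by
    have := Real.GammaIntegral_convergent (s := n + 1) (by positivity)
    simpa using this
  have hle : ‖∫ r in Set.Ioi (0 : ℝ), a (Real.sqrt r) * (Real.exp (-r) * r ^ n : ℝ)‖
      ≤ ∫ r in Set.Ioi (0 : ℝ), ‖a‖ * (Real.exp (-r) * r ^ n) := by
    refine norm_integral_le_of_norm_le (hint.const_mul _) ?_
    filter_upwards [ae_norm_comp_sqrt_le a, ae_restrict_mem measurableSet_Ioi] with r hr hr0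
    have h0 : (0 : ℝ) < r := hr0
    rw [norm_mul, Complex.norm_real, Real.norm_of_nonneg (by positivity)]
    gcongr
  have hG' : ∫ r in Set.Ioi (0 : ℝ), Real.exp (-r) * r ^ n = n.factorial := by
    simpa using hG
  rw [integral_const_mul, hG'] at hle
  have hpos : (0 : ℝ) < n.factorial := by positivity
  rw [gammaFun, norm_mul, norm_div, norm_one, Complex.norm_natCast]
  rw [div_mul_eq_mul_div, one_mul, div_le_iff₀ hpos]
  exact hle

/-- The eigenvalue sequence `γ_a`, as an element of `ℓ_∞(ℤ₊)`. -/
def gammaSeq (a : LinftyPos) : LinftySeq :=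
  ⟨gammaFun a, memℓp_infty ⟨‖a‖, by
    rintro _ ⟨n, rfl⟩
    exact norm_gammaFun_le a n⟩⟩

/-- The set `𝔊` of all eigenvalue sequences `γ_a`, `a ∈ L_∞(ℝ₊)`. -/
def eigenSequences : Set LinftySeq :=
  Set.range gammaSeq

/-- The C*-subalgebra `𝒢` of `ℓ_∞(ℤ₊)` generated by `𝔊` (which contains the unit `γ₁ = 1`). -/
def eigenAlgebra : StarSubalgebra ℂ LinftySeq :=
  (StarAlgebra.adjoin ℂ eigenSequences).topologicalClosure

/-! ### The algebra `RO(ℤ₊)` -/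

/-- The square-root metric on `ℤ₊`. -/
def sqrtDist (m n : ℕ) : ℝ :=
  |Real.sqrt m - Real.sqrt n|

/-- The modulus of continuity of a sequence with respect to the square-root metric. -/
def sqrtModulus (σ : ℕ → ℂ) (δ : ℝ) : ℝ≥0∞ :=
  ⨆ (m : ℕ) (n : ℕ) (_ : sqrtDist m n ≤ δ), ‖σ n - σ m‖ₑ

theorem tendsto_sqrtModulus_iff (σ : ℕ → ℂ) :
    Tendsto (sqrtModulus σ) (𝓝[>] 0) (𝓝 0) ↔
      ∀ ε > 0, ∃ δ > 0, ∀ m n, sqrtDist m n ≤ δ → ‖σ n - σ m‖ ≤ ε := by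
  rw [ENNReal.tendsto_nhds_zero]
  constructor
  · intro h ε hε
    have h1 := h (ENNReal.ofReal ε) (by simpa using hε)
    obtain ⟨δ, hδ, hδ0⟩ := (h1.and self_mem_nhdsWithin).exists
    refine ⟨δ, hδ0, fun m n hmn => ?_⟩
    have h2 : ‖σ n - σ m‖ₑ ≤ ENNReal.ofReal ε :=
      (le_iSup_of_le m (le_iSup_of_le n
        (le_iSup (fun _ : sqrtDist m n ≤ δ => ‖σ n - σ m‖ₑ) hmn))).trans hδ
    rwa [← ofReal_norm, ENNReal.ofReal_le_ofReal_iff hε.le] at h2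
  · intro h ε hε
    rcases eq_or_ne ε ∞ with rfl | hε'
    · simp
    obtain ⟨δ, hδ, h1⟩ := h ε.toReal (ENNReal.toReal_pos hε.ne' hε')
    filter_upwards [Ioc_mem_nhdsGT hδ] with t ht
    refine iSup_le fun m => iSup_le fun n => iSup_le fun hmn => ?_
    rw [← ofReal_norm]
    exact ENNReal.ofReal_le_of_le_toReal (h1 m n (hmn.trans ht.2))

/-- `RO(ℤ₊)`: the bounded sequences that are uniformly continuous with respect to the square-root
metric. -/
def RO : StarSubalgebra ℂ LinftySeq where
  carrier := {σ | Tendsto (sqrtModulus σ) (𝓝[>] 0) (𝓝 0)}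
  add_mem' := by
    intro σ τ hσ hτ
    simp only [Set.mem_ofPred_eq, tendsto_sqrtModulus_iff] at hσ hτ ⊢
    intro ε hε
    obtain ⟨δ, hδ, h1⟩ := hσ (ε / 2) (by positivity)
    obtain ⟨δ', hδ', h2⟩ := hτ (ε / 2) (by positivity)
    refine ⟨min δ δ', lt_min hδ hδ', fun m n h => ?_⟩
    have h3 := h1 m n (h.trans (min_le_left _ _))
    have h4 := h2 m n (h.trans (min_le_right _ _))
    have h5 : (σ + τ) n - (σ + τ) m = (σ n - σ m) + (τ n - τ m) := by
      simp only [lp.coeFn_add, Pi.add_apply]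
      ring
    rw [h5]
    exact (norm_add_le _ _).trans (by linarith)
  mul_mem' := by
    intro σ τ hσ hτ
    simp only [Set.mem_ofPred_eq, tendsto_sqrtModulus_iff] at hσ hτ ⊢
    intro ε hε
    have hS : 0 < ‖σ‖ + 1 := by positivity
    have hT : 0 < ‖τ‖ + 1 := by positivity
    obtain ⟨δ, hδ, h1⟩ := hσ (ε / 2 / (‖τ‖ + 1)) (by positivity)
    obtain ⟨δ', hδ', h2⟩ := hτ (ε / 2 / (‖σ‖ + 1)) (by positivity)
    refine ⟨min δ δ', lt_min hδ hδ', fun m n h => ?_⟩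
    have h3 := h1 m n (h.trans (min_le_left _ _))
    have h4 := h2 m n (h.trans (min_le_right _ _))
    have h5 : (σ * τ) n - (σ * τ) m = σ n * (τ n - τ m) + (σ n - σ m) * τ m := by
      simp only [lp.infty_coeFn_mul, Pi.mul_apply]
      ring
    have h6 : ‖σ n‖ ≤ ‖σ‖ + 1 := (lp.norm_apply_le_norm (by simp) σ n).trans (by linarith)
    have h7 : ‖τ m‖ ≤ ‖τ‖ + 1 := (lp.norm_apply_le_norm (by simp) τ m).trans (by linarith)
    rw [h5]
    calc _ ≤ ‖σ n‖ * ‖τ n - τ m‖ + ‖σ n - σ m‖ * ‖τ m‖ := by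
          refine (norm_add_le _ _).trans ?_
          rw [norm_mul, norm_mul]
      _ ≤ (‖σ‖ + 1) * (ε / 2 / (‖σ‖ + 1)) + (ε / 2 / (‖τ‖ + 1)) * (‖τ‖ + 1) := by gcongr
      _ = ε := by
          field_simp
          ring
  algebraMap_mem' := by
    intro c
    simp only [Set.mem_ofPred_eq, tendsto_sqrtModulus_iff]
    intro ε hε
    refine ⟨1, one_pos, fun m n _ => ?_⟩
    have h : (algebraMap ℂ LinftySeq c) n - (algebraMap ℂ LinftySeq c) m = 0 := by
      rw [Algebra.algebraMap_eq_smul_one]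
      simp [lp.coeFn_smul]
    rw [h, norm_zero]
    exact hε.le
  star_mem' := by
    intro σ hσ
    simp only [Set.mem_ofPred_eq, tendsto_sqrtModulus_iff] at hσ ⊢
    intro ε hε
    obtain ⟨δ, hδ, h1⟩ := hσ ε hε
    refine ⟨δ, hδ, fun m n h => ?_⟩
    have h5 : (star σ) n - (star σ) m = star (σ n - σ m) := by
      simp [lp.star_apply]
    rw [h5, norm_star]
    exact h1 m n h

end RadialFock

end

noncomputable section

namespace RadialFock

/-! After the substitution r = x², γ_a(n) is the mean of a against a probability density p_n on the
half-line (`sqrtGammaDensity`), concentrated near √n with a width that stays bounded as n grows.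
Everything about sequences follows from two facts about p_n.

Inclusion in RO: p_{n+1} = x²/(n+1) · p_n, and a second moment computation bounds the L¹ distance of
p_n and p_{n+1} by 1/√(n+1). Hence γ_a is Lipschitz for the square-root metric.

Density: by Stirling's formula and Scheffé's lemma, p_n centred at √n converges in L¹ to the
Gaussian density of variance 1/4. So, up to a null sequence, γ_a(n) is the convolution of a with
that Gaussian, evaluated at √n. Null sequences lie in the closure of 𝔊, because geometric sequences
are eigenvalue sequences and produce the unit vectors in the limit. It remains to remove the
Gaussian blur. Smoothing the profile first gives every variance at least 1/4; the narrower Gaussians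
are reached by expanding exp(-wy²) in powers of y² around a smaller parameter, the terms of the
expansion being derivatives in the parameter. Each such expansion reaches almost twice as far, so
iteration gives all w (`exp_mem_admissibleKernels`). A sequence σ in RO is then approximated by
averaging x ↦ σ(⌊x²⌋) against a narrow Gaussian at √n.

Operators: the inner product of e_n with an entire f is a Taylor coefficient of f, so the e_n form a
Hilbert basis, and in polar coordinates a radial Toeplitz operator is seen to be diagonal in it with
eigenvalues γ_a(n). The passage from bounded sequences to diagonal operators is an isometric
*-homomorphism, which carries 𝒢 onto the Toeplitz algebra. -/

/-! ### Eigenvalue sequences as averages against probability densities -/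

/-- The density of the law of `√r` when `r` has the law `e^{-r} rⁿ / n!` on the half-line. -/
def sqrtGammaDensity (n : ℕ) (x : ℝ) : ℝ :=
  2 * x ^ (2 * n + 1) * Real.exp (-x ^ 2) / n.factorial

theorem sqrtGammaDensity_nonneg (n : ℕ) {x : ℝ} (hx : 0 ≤ x) : 0 ≤ sqrtGammaDensity n x := by
  unfold sqrtGammaDensity
  positivity

theorem integral_Ioi_pow_mul_exp (n : ℕ) {b : ℝ} (hb : 0 < b) :
    ∫ x in Set.Ioi (0 : ℝ), x ^ (2 * n + 1) * Real.exp (-b * x ^ 2) =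
      n.factorial / (2 * b ^ (n + 1)) := by
  have h := integral_rpow_mul_exp_neg_mul_rpow (p := 2) (q := ((2 * n + 1 : ℕ) : ℝ)) (b := b)
    (by norm_num) (by have : (0 : ℝ) ≤ ((2 * n + 1 : ℕ) : ℝ) := Nat.cast_nonneg _
                      linarith) hb
  simp only [Real.rpow_natCast, Real.rpow_two] at h
  rw [h]
  have h1 : (((2 * n + 1 : ℕ) : ℝ) + 1) / 2 = n + 1 := by push_cast; ring
  rw [neg_div, h1, Real.Gamma_nat_eq_factorial, Real.rpow_neg hb.le]
  have h2 : b ^ ((n : ℝ) + 1) = b ^ (n + 1) := by exact_mod_cast Real.rpow_natCast b (n + 1)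
  rw [h2]
  field_simp

theorem integrableOn_Ioi_pow_mul_exp (n : ℕ) {b : ℝ} (hb : 0 < b) :
    IntegrableOn (fun x : ℝ => x ^ (2 * n + 1) * Real.exp (-b * x ^ 2)) (Set.Ioi 0) := by
  -- A non-integrable function has Bochner integral 0, while this integral is positive.
  refine not_imp_comm.1 integral_undef ?_
  rw [integral_Ioi_pow_mul_exp n hb]
  positivity

theorem integrableOn_sqrtGammaDensity (n : ℕ) :
    IntegrableOn (sqrtGammaDensity n) (Set.Ioi 0) := by
  refine ((integrableOn_Ioi_pow_mul_exp n one_pos).const_mul (2 / n.factorial)).congr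
    (ae_of_all _ fun x => ?_)
  simp only [sqrtGammaDensity, neg_mul, one_mul]
  ring

theorem integral_sqrtGammaDensity (n : ℕ) : ∫ x in Set.Ioi 0, sqrtGammaDensity n x = 1 := by
  have h : ∀ x, sqrtGammaDensity n x
      = (2 / n.factorial) * (x ^ (2 * n + 1) * Real.exp (-1 * x ^ 2)) := fun x => by
    simp only [sqrtGammaDensity, neg_mul, one_mul]
    ring
  simp_rw [h]
  rw [integral_const_mul, integral_Ioi_pow_mul_exp n one_pos]
  have := n.factorial_ne_zero
  field_simp
  simp

/-- Turns the even moments of the densities into total masses, which are all 1. -/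
theorem sq_mul_sqrtGammaDensity (n : ℕ) (x : ℝ) :
    x ^ 2 * sqrtGammaDensity n x = (n + 1) * sqrtGammaDensity (n + 1) x := by
  simp only [sqrtGammaDensity, Nat.factorial_succ]
  push_cast
  have := n.factorial_ne_zero
  field_simp
  ring

theorem gammaFun_eq (a : LinftyPos) (n : ℕ) :
    gammaFun a n = ∫ x in Set.Ioi (0 : ℝ), a x * (sqrtGammaDensity n x : ℂ) := by
  rw [gammaFun, ← integral_comp_rpow_Ioi_of_pos (p := 2) two_pos, ← integral_const_mul]
  refine setIntegral_congr_fun measurableSet_Ioi fun x hx => ?_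
  have hx0 : (0 : ℝ) < x := hx
  have h1 : x ^ ((2 : ℝ) - 1) = x := by norm_num
  simp only [Real.rpow_two, h1, Real.sqrt_sq hx0.le, sqrtGammaDensity, Complex.real_smul]
  push_cast
  ring

theorem ae_norm_le (a : LinftyPos) :
    ∀ᵐ x ∂(volume : Measure ℝ).restrict (Set.Ioi 0), ‖a x‖ ≤ ‖a‖ := by
  have h1 := ae_le_eLpNormEssSup (f := a) (μ := (volume : Measure ℝ).restrict (Set.Ioi 0))
  filter_upwards [h1] with x hx
  rw [Lp.norm_def, eLpNorm_exponent_top]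
  have h2 : eLpNormEssSup a ((volume : Measure ℝ).restrict (Set.Ioi 0)) ≠ ∞ := by
    have := (Lp.memLp a).2
    rw [eLpNorm_exponent_top] at this
    exact this.ne
  simpa using ENNReal.toReal_mono h2 hx

theorem integrableOn_mul_sqrtGammaDensity (a : LinftyPos) (n : ℕ) :
    IntegrableOn (fun x => a x * (sqrtGammaDensity n x : ℂ)) (Set.Ioi 0) :=
  (integrableOn_sqrtGammaDensity n).ofReal.bdd_mul (Lp.aestronglyMeasurable a) (ae_norm_le a)

/-! ### Lipschitz continuity of the eigenvalue sequences and closedness of RO -/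

/-- The difference of the densities is u · p_n with u = x²/(n+1) - 1, and u has second moment
1/(n+1) under p_n. With s = √(n+1), the inequality |u| ≤ (s/2)u² + 1/(2s) then integrates to 1/s;
written through p_n, p_{n+1} and p_{n+2}, the right-hand side needs only total masses. -/
theorem integral_abs_sqrtGammaDensity_sub_le (n : ℕ) :
    ∫ x in Set.Ioi 0, |sqrtGammaDensity (n + 1) x - sqrtGammaDensity n x| ≤
      1 / Real.sqrt (n + 1) := by
  set s : ℝ := Real.sqrt (n + 1) with hs
  have hn : (0 : ℝ) < n + 1 := by positivity
  have hs0 : 0 < s := Real.sqrt_pos.2 hn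
  have hs2 : s ^ 2 = n + 1 := Real.sq_sqrt hn.le
  have hi := integrableOn_sqrtGammaDensity
  have hbound : ∀ x ∈ Set.Ioi (0 : ℝ), |sqrtGammaDensity (n + 1) x - sqrtGammaDensity n x| ≤
      (s / 2 * ((n + 2) / (n + 1))) * sqrtGammaDensity (n + 2) x
        - s * sqrtGammaDensity (n + 1) x + (s / 2 + 1 / (2 * s)) * sqrtGammaDensity n x := by
    intro x hx
    have h1 := sq_mul_sqrtGammaDensity n x
    have h2 := sq_mul_sqrtGammaDensity (n + 1) x
    push_cast at h2
    have h3 : sqrtGammaDensity (n + 1) x = x ^ 2 / (n + 1) * sqrtGammaDensity n x := by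
      field_simp; linarith
    have h4 : sqrtGammaDensity (n + 2) x
        = x ^ 2 / (n + 2) * (x ^ 2 / (n + 1) * sqrtGammaDensity n x) := by
      rw [← h3]; field_simp
      rw [show n + 2 = n + 1 + 1 from rfl]; linarith
    rw [h4, h3]
    set d := sqrtGammaDensity n x
    have hd : 0 ≤ d := sqrtGammaDensity_nonneg n (le_of_lt hx)
    set u : ℝ := x ^ 2 / (n + 1) - 1 with hu
    have h5 : x ^ 2 / (n + 1) * d - d = u * d := by rw [hu]; ring
    have h6 : |u| ≤ s / 2 * u ^ 2 + 1 / (2 * s) := by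
      have h7 : 0 ≤ (s * |u| - 1) ^ 2 / (2 * s) := by positivity
      have h8 : (s * |u| - 1) ^ 2 / (2 * s) = s / 2 * |u| ^ 2 + 1 / (2 * s) - |u| := by
        field_simp; ring
      rw [sq_abs] at h8
      linarith
    rw [h5, abs_mul, abs_of_nonneg hd]
    refine (mul_le_mul_of_nonneg_right h6 hd).trans_eq ?_
    rw [hu]
    field_simp
    ring
  have hI1 : IntegrableOn (fun x => (s / 2 * ((n + 2) / (n + 1))) * sqrtGammaDensity (n + 2) x)
      (Set.Ioi 0) := (hi _).const_mul _
  have hI2 : IntegrableOn (fun x => s * sqrtGammaDensity (n + 1) x) (Set.Ioi 0) :=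
    (hi _).const_mul _
  have hI3 : IntegrableOn (fun x => (s / 2 + 1 / (2 * s)) * sqrtGammaDensity n x) (Set.Ioi 0) :=
    (hi _).const_mul _
  refine (setIntegral_mono_on ((hi _).sub (hi _)).abs ((hI1.sub hI2).add hI3) measurableSet_Ioi
    hbound).trans_eq ?_
  rw [integral_add' (hI1.sub hI2) hI3, integral_sub' hI1 hI2, integral_const_mul,
    integral_const_mul, integral_const_mul]
  simp only [integral_sqrtGammaDensity]
  rw [show (n : ℝ) + 2 = s ^ 2 + 1 by rw [hs2]; ring, ← hs2]
  field_simp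
  ring

theorem norm_gammaFun_succ_sub_le (a : LinftyPos) (n : ℕ) :
    ‖gammaFun a (n + 1) - gammaFun a n‖ ≤ 2 * ‖a‖ * (Real.sqrt (n + 1) - Real.sqrt n) := by
  have h1 : ‖gammaFun a (n + 1) - gammaFun a n‖ ≤
      ∫ x in Set.Ioi 0, ‖a‖ * |sqrtGammaDensity (n + 1) x - sqrtGammaDensity n x| := by
    rw [gammaFun_eq, gammaFun_eq, ← integral_sub (integrableOn_mul_sqrtGammaDensity a _)
      (integrableOn_mul_sqrtGammaDensity a _)]
    refine norm_integral_le_of_norm_le (((integrableOn_sqrtGammaDensity _).sub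
      (integrableOn_sqrtGammaDensity _)).abs.const_mul _) ?_
    filter_upwards [ae_norm_le a] with x hx
    rw [← mul_sub, norm_mul, ← Complex.ofReal_sub, Complex.norm_real, Real.norm_eq_abs]
    gcongr
  rw [integral_const_mul] at h1
  -- Here the square-root metric enters: √(n+1) - √n = 1/(√(n+1) + √n) is at least 1/(2√(n+1)), and
  -- increments of this form telescope.
  have h2 : 1 / Real.sqrt (n + 1) ≤ 2 * (Real.sqrt (n + 1) - Real.sqrt n) := by
    have hp : (0 : ℝ) < n + 1 := by positivity
    have h3 := Real.sqrt_pos.2 hp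
    have h4 := Real.sq_sqrt hp.le
    have h5 := Real.sq_sqrt (show (0 : ℝ) ≤ n by positivity)
    have h6 := Real.sqrt_nonneg (n : ℝ)
    rw [div_le_iff₀ h3]
    nlinarith [sq_nonneg (Real.sqrt (n + 1) - Real.sqrt n)]
  calc _ ≤ ‖a‖ * (1 / Real.sqrt (n + 1)) :=
        h1.trans (mul_le_mul_of_nonneg_left (integral_abs_sqrtGammaDensity_sub_le n) (norm_nonneg _))
    _ ≤ ‖a‖ * (2 * (Real.sqrt (n + 1) - Real.sqrt n)) := by gcongr
    _ = _ := by ring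

theorem norm_gammaFun_sub_le (a : LinftyPos) (m n : ℕ) :
    ‖gammaFun a n - gammaFun a m‖ ≤ 2 * ‖a‖ * sqrtDist m n := by
  wlog h : m ≤ n generalizing m n
  · rw [norm_sub_rev, sqrtDist, abs_sub_comm]
    exact this n m (le_of_not_ge h)
  have h1 : ‖gammaFun a n - gammaFun a m‖ ≤ 2 * ‖a‖ * (Real.sqrt n - Real.sqrt m) := by
    induction n, h using Nat.le_induction with
    | base => simp
    | succ k hk ih =>
      have h2 := norm_gammaFun_succ_sub_le a k
      have h3 := norm_sub_le_norm_sub_add_norm_sub (gammaFun a (k + 1)) (gammaFun a k)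
        (gammaFun a m)
      push_cast
      linarith
  rwa [sqrtDist, abs_sub_comm, abs_of_nonneg]
  exact sub_nonneg.2 (Real.sqrt_le_sqrt (by exact_mod_cast h))

theorem mem_RO_iff (σ : LinftySeq) :
    σ ∈ RO ↔ ∀ ε > 0, ∃ δ > 0, ∀ m n, sqrtDist m n ≤ δ → ‖σ n - σ m‖ ≤ ε :=
  tendsto_sqrtModulus_iff σ

theorem eigenSequences_subset_RO : eigenSequences ⊆ (RO : Set LinftySeq) := by
  rintro _ ⟨a, rfl⟩
  rw [SetLike.mem_coe, mem_RO_iff]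
  intro ε hε
  refine ⟨ε / (2 * ‖a‖ + 1), by positivity, fun m n h => (norm_gammaFun_sub_le a m n).trans ?_⟩
  rw [le_div_iff₀ (by positivity)] at h
  have : 0 ≤ sqrtDist m n := abs_nonneg _
  nlinarith [norm_nonneg a]

theorem isClosed_RO : IsClosed (RO : Set LinftySeq) := by
  refine isClosed_of_closure_subset fun σ hσ => ?_
  rw [SetLike.mem_coe, mem_RO_iff]
  intro ε hε
  obtain ⟨τ, hτ, hd⟩ := Metric.mem_closure_iff.1 hσ (ε / 3) (by positivity)
  obtain ⟨δ, hδ, h⟩ := (mem_RO_iff τ).1 hτ (ε / 3) (by positivity)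
  refine ⟨δ, hδ, fun m n hmn => ?_⟩
  have h1 : ∀ k, ‖σ k - τ k‖ ≤ ε / 3 := fun k =>
    (lp.norm_apply_le_norm (by simp) (σ - τ) k).trans (by rw [← dist_eq_norm]; exact hd.le)
  have h2 : σ n - σ m = (σ n - τ n) + (τ n - τ m) - (σ m - τ m) := by ring
  rw [h2]
  refine (norm_sub_le _ _).trans ?_
  have := norm_add_le (σ n - τ n) (τ n - τ m)
  linarith [h1 n, h1 m, h m n hmn]

/-! ### Taylor coefficients, the monomial basis and radial symbols -/

/-- The Taylor coefficients of an entire function are its Fourier coefficients on circles. -/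
theorem integral_star_circleMap_pow_mul {F : ℂ → ℂ} (hF : Differentiable ℂ F) (n : ℕ) {r : ℝ}
    (hr : 0 < r) :
    ∫ θ in Set.Ioo (-Real.pi) Real.pi, star (circleMap 0 r θ) ^ n * F (circleMap 0 r θ) =
      2 * Real.pi * r ^ (2 * n) * ((n.factorial : ℂ)⁻¹ * iteratedDeriv n F 0) := by
  have h1 := DifferentiableOn.circleIntegral_one_div_sub_center_pow_smul hr n
    (hF.differentiableOn (s := Metric.closedBall 0 r))
  have hne : ∀ θ, circleMap 0 r θ ≠ 0 := fun θ => circleMap_ne_center hr.ne'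
  have hmul : ∀ θ, circleMap 0 r θ * star (circleMap 0 r θ) = (r : ℂ) ^ 2 := fun θ => by
    rw [Complex.star_def, Complex.mul_conj, Complex.normSq_eq_norm_sq, norm_circleMap_zero,
      sq_abs, Complex.ofReal_pow]
  have hper : Function.Periodic
      (fun θ => star (circleMap 0 r θ) ^ n * F (circleMap 0 r θ)) (2 * Real.pi) :=
    fun θ => by simp only [periodic_circleMap 0 r θ]
  have hpi : (-Real.pi : ℝ) ≤ Real.pi := by linarith [Real.pi_pos]
  have h2 := hper.intervalIntegral_add_eq (-Real.pi) 0
  have h4 : -Real.pi + 2 * Real.pi = Real.pi := by ring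
  rw [h4, zero_add] at h2
  rw [← integral_Ioc_eq_integral_Ioo, ← intervalIntegral.integral_of_le hpi, h2]
  -- On the circle the conjugate of z is r²/z and dθ = dz/(iz), so this is the Cauchy integrand for
  -- the n-th derivative.
  have h3 : ∀ θ, star (circleMap 0 r θ) ^ n * F (circleMap 0 r θ) =
      ((r : ℂ) ^ (2 * n) * Complex.I⁻¹) * (deriv (circleMap 0 r) θ •
        (1 / (circleMap 0 r θ - 0) ^ (n + 1)) • F (circleMap 0 r θ)) := fun θ => by
    have h5 := hne θ
    have h6 : star (circleMap 0 r θ) = (r : ℂ) ^ 2 / circleMap 0 r θ := by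
      rw [← hmul θ]; field_simp
    rw [h6, deriv_circleMap, smul_eq_mul, smul_eq_mul, sub_zero, div_pow, ← pow_mul]
    have := Complex.I_ne_zero
    field_simp
    ring
  simp_rw [h3]
  rw [intervalIntegral.integral_const_mul]
  rw [circleIntegral] at h1
  rw [h1, smul_eq_mul]
  have := Complex.I_ne_zero
  field_simp

theorem integrableOn_comp_polarCoord_symm {h : ℂ → ℂ} (hm : Measurable h) (hi : Integrable h) :
    IntegrableOn (fun p : ℝ × ℝ => p.1 • h (Complex.polarCoord.symm p)) polarCoord.target := by
  have hc : Continuous fun p : ℝ × ℝ => Complex.polarCoord.symm p := by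
    simp only [Complex.polarCoord_symm_apply]
    fun_prop
  refine ⟨(measurable_fst.smul (hm.comp hc.measurable)).aestronglyMeasurable, ?_⟩
  have h1 := hi.2
  rw [hasFiniteIntegral_iff_enorm, ← Complex.lintegral_comp_polarCoord_symm] at h1
  rw [hasFiniteIntegral_iff_enorm]
  refine lt_of_eq_of_lt (setLIntegral_congr_fun polarCoord.open_target.measurableSet ?_) h1
  rintro p ⟨hp, -⟩
  simp only [enorm_smul, smul_eq_mul]
  rw [Real.enorm_eq_ofReal (le_of_lt hp)]

/-- In polar coordinates a is constant on each circle, so the angular integral extracts the n-th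
Taylor coefficient times 2πr^{2n}; together with the Jacobian r and the Gaussian weight this leaves
exactly the density p_n. -/
theorem integral_star_pow_mul_radial {F : ℂ → ℂ} (hF : Differentiable ℂ F) {a : ℝ → ℂ}
    (ha : Measurable a) (n : ℕ)
    (hi : Integrable (fun z : ℂ => star z ^ n * (a ‖z‖ * F z)) gaussian) :
    ∫ z, star z ^ n * (a ‖z‖ * F z) ∂gaussian =
      iteratedDeriv n F 0 * ∫ r in Set.Ioi (0 : ℝ), a r * (sqrtGammaDensity n r : ℂ) := by
  set h : ℂ → ℂ := fun z =>
    (Real.pi⁻¹ * Real.exp (-‖z‖ ^ 2) : ℝ) • (star z ^ n * (a ‖z‖ * F z)) with hh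
  have hnn : ∀ z : ℂ, 0 ≤ Real.pi⁻¹ * Real.exp (-‖z‖ ^ 2) := fun z => by positivity
  have hm : Measurable h := by
    have h1 : Measurable F := hF.continuous.measurable
    have h2 : Measurable fun z : ℂ => a ‖z‖ := ha.comp measurable_norm
    have h3 : Measurable fun z : ℂ => star z ^ n := (continuous_star.pow n).measurable
    have h4 : Measurable fun z : ℂ => Real.pi⁻¹ * Real.exp (-‖z‖ ^ 2) := by fun_prop
    exact h4.smul (h3.mul (h2.mul h1))
  have hint : Integrable h := by
    rw [gaussian, integrable_withDensity_iff_integrable_smul₀'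
      measurable_gaussianDensity.aemeasurable (ae_of_all _ fun _ => by simp)] at hi
    refine hi.congr (ae_of_all _ fun z => ?_)
    simp only [hh, ENNReal.toReal_ofReal (hnn z)]
  have h1 : ∫ z, star z ^ n * (a ‖z‖ * F z) ∂gaussian = ∫ z, h z := by
    rw [gaussian, integral_withDensity_eq_integral_toReal_smul measurable_gaussianDensity
      (ae_of_all _ fun _ => by simp)]
    refine integral_congr_ae (ae_of_all _ fun z => ?_)
    simp only [hh, ENNReal.toReal_ofReal (hnn z)]
  have h2 := integrableOn_comp_polarCoord_symm hm hint
  rw [h1, ← Complex.integral_comp_polarCoord_symm]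
  have htar : polarCoord.target = Set.Ioi (0 : ℝ) ×ˢ Set.Ioo (-Real.pi) Real.pi := rfl
  rw [htar] at h2 ⊢
  rw [Measure.volume_eq_prod] at h2 ⊢
  rw [setIntegral_prod _ h2, ← integral_const_mul]
  refine setIntegral_congr_fun measurableSet_Ioi fun r hr => ?_
  have hr0 : (0 : ℝ) < r := hr
  have h3 : ∀ θ : ℝ, r • h (Complex.polarCoord.symm (r, θ)) =
      (r * (Real.pi⁻¹ * Real.exp (-r ^ 2)) * a r) *
        (star (circleMap 0 r θ) ^ n * F (circleMap 0 r θ)) := by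
    intro θ
    have h4 : Complex.polarCoord.symm (r, θ) = circleMap 0 r θ := by
      simp [circleMap, Complex.polarCoord_symm_apply, Complex.exp_mul_I]
    simp only [hh, h4, norm_circleMap_zero, abs_of_pos hr0, Complex.real_smul]
    push_cast
    ring
  simp only [h3]
  rw [integral_const_mul, integral_star_circleMap_pow_mul hF n hr0]
  have hpi : (Real.pi : ℂ) ≠ 0 := by exact_mod_cast Real.pi_ne_zero
  have hfac : (n.factorial : ℂ) ≠ 0 := by exact_mod_cast n.factorial_ne_zero
  simp only [sqrtGammaDensity]
  push_cast
  field_simp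
  ring

/-- An element of the Fock space is the class of an entire function. -/
theorem exists_entire (f : FockSpace) :
    ∃ F : ℂ → ℂ, Differentiable ℂ F ∧ fockInclusion f =ᵐ[gaussian] F :=
  f.2

theorem inner_bargmannProjection (f : FockSpace) (g : Lp ℂ 2 gaussian) :
    inner ℂ f (bargmannProjection g) = inner ℂ (fockInclusion f) g :=
  Submodule.inner_orthogonalProjectionOnto_eq_of_mem_left (K := fockSubmodule) f g

theorem inner_fockInclusion (f g : FockSpace) :
    inner ℂ (fockInclusion f) (fockInclusion g) = inner ℂ f g := rfl

theorem fockInclusion_monomial_ae (n : ℕ) :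
    fockInclusion (monomial n) =ᵐ[gaussian] fun z : ℂ => z ^ n / (Real.sqrt (n.factorial) : ℂ) :=
  (memLp_monomial n).coeFn_toLp

/-- Holding for arbitrary f, and not only for monomials, this diagonalizes the Toeplitz operator
without any convergence argument for expansions. -/
theorem inner_monomial_mul_radial {φ : LinftyC} {a : LinftyPos} (h : HasRadialProfile φ a)
    (n : ℕ) (f : FockSpace) {F : ℂ → ℂ} (hF : Differentiable ℂ F)
    (hf : fockInclusion f =ᵐ[gaussian] F) :
    inner ℂ (fockInclusion (monomial n)) (multiplication φ (fockInclusion f)) =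
      gammaFun a n * ((Real.sqrt (n.factorial) : ℂ)⁻¹ * iteratedDeriv n F 0) := by
  have h1 : (fun z => inner ℂ (fockInclusion (monomial n) z)
      (multiplication φ (fockInclusion f) z)) =ᵐ[gaussian]
      fun z => (Real.sqrt (n.factorial) : ℂ)⁻¹ * (star z ^ n * (a ‖z‖ * F z)) := by
    filter_upwards [fockInclusion_monomial_ae n, multiplication_apply_ae φ (fockInclusion f), hf,
      gaussian_absolutelyContinuous.ae_le h] with z h1 h2 h3 h4
    rw [h1, h2, h3, h4, RCLike.inner_apply]
    simp only [map_div₀, map_pow, Complex.conj_ofReal, Complex.star_def]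
    ring
  have hs : (Real.sqrt (n.factorial) : ℂ) ≠ 0 := by
    have : Real.sqrt (n.factorial) ≠ 0 := by positivity
    exact_mod_cast this
  have hi : Integrable (fun z : ℂ => star z ^ n * (a ‖z‖ * F z)) gaussian := by
    have h2 := (L2.integrable_inner (𝕜 := ℂ) (fockInclusion (monomial n))
      (multiplication φ (fockInclusion f))).congr h1
    refine (h2.const_mul (Real.sqrt (n.factorial) : ℂ)).congr (ae_of_all _ fun z => ?_)
    simp only
    rw [mul_inv_cancel_left₀ hs]
  rw [L2.inner_def, integral_congr_ae h1, integral_const_mul,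
    integral_star_pow_mul_radial hF (Lp.stronglyMeasurable a).measurable n hi, ← gammaFun_eq]
  ring

/-- Every profile is the profile of a radial symbol. -/
theorem exists_hasRadialProfile (a : LinftyPos) : ∃ φ : LinftyC, HasRadialProfile φ a := by
  have hm : Measurable fun z : ℂ => a ‖z‖ :=
    (Lp.stronglyMeasurable a).measurable.comp measurable_norm
  have hb : ∀ᵐ z : ℂ, ‖a ‖z‖‖ ≤ ‖a‖ := by
    have h := ae_norm_le a
    rw [ae_restrict_iff' measurableSet_Ioi] at h
    obtain ⟨t, hts, ht, ht0⟩ := exists_measurable_superset_of_null (ae_iff.1 h)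
    rw [ae_iff]
    -- The exceptional radii form a null set, whose preimage under the norm is null by polar
    -- coordinates. The origin is separated because the profile is controlled only on positive
    -- radii.
    refine measure_mono_null (t := ((fun z : ℂ => ‖z‖) ⁻¹' (t ∩ Set.Ioi 0)) ∪ {0})
      (fun z hz => ?_) ?_
    · by_cases hz0 : z = 0
      · exact Or.inr hz0
      · refine Or.inl ⟨hts ?_, norm_pos_iff.2 hz0⟩
        simp only [Set.mem_ofPred_eq, Classical.not_imp, Set.mem_Ioi]
        exact ⟨norm_pos_iff.2 hz0, hz⟩
    refine measure_union_null ?_ (by simp)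
    have hmeas : MeasurableSet ((fun z : ℂ => ‖z‖) ⁻¹' (t ∩ Set.Ioi 0)) :=
      measurable_norm (ht.inter measurableSet_Ioi)
    rw [← lintegral_indicator_one hmeas, ← Complex.lintegral_comp_polarCoord_symm]
    have htar : polarCoord.target = Set.Ioi (0 : ℝ) ×ˢ Set.Ioo (-Real.pi) Real.pi := rfl
    rw [lintegral_eq_zero_iff']
    · have hnull : ∀ᵐ p : ℝ × ℝ, p.1 ∉ t := by
        rw [Measure.volume_eq_prod]
        exact Measure.quasiMeasurePreserving_fst.ae (measure_eq_zero_iff_ae_notMem.1 ht0)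
      filter_upwards [ae_restrict_of_ae hnull,
        ae_restrict_mem polarCoord.open_target.measurableSet] with p hp hp'
      have h0 : (0 : ℝ) < p.1 := hp'.1
      simp [Set.indicator, abs_of_pos h0, hp]
    · have hc : Continuous fun p : ℝ × ℝ => Complex.polarCoord.symm p := by
        simp only [Complex.polarCoord_symm_apply]
        fun_prop
      exact ((ENNReal.measurable_ofReal.comp measurable_fst).smul
        ((measurable_one.indicator hmeas).comp hc.measurable)).aemeasurable
  refine ⟨(memLp_top_of_bound hm.aestronglyMeasurable _ hb).toLp, ?_⟩
  exact (memLp_top_of_bound hm.aestronglyMeasurable _ hb).coeFn_toLp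

theorem sqrt_factorial_ne_zero (n : ℕ) : (Real.sqrt (n.factorial) : ℂ) ≠ 0 := by
  have : Real.sqrt (n.factorial) ≠ 0 := by positivity
  exact_mod_cast this

/-- The case a = 1 of the radial formula, where the density has mass 1. Both orthonormality and
completeness of the monomials are read off from it. -/
theorem inner_monomial (n : ℕ) (f : FockSpace) {F : ℂ → ℂ} (hF : Differentiable ℂ F)
    (hf : fockInclusion f =ᵐ[gaussian] F) :
    inner ℂ (monomial n) f = (Real.sqrt (n.factorial) : ℂ)⁻¹ * iteratedDeriv n F 0 := by
  have h1 : (fun z => inner ℂ (fockInclusion (monomial n) z) (fockInclusion f z)) =ᵐ[gaussian]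
      fun z => (Real.sqrt (n.factorial) : ℂ)⁻¹ * (star z ^ n * ((1 : ℂ) * F z)) := by
    filter_upwards [fockInclusion_monomial_ae n, hf] with z h1 h2
    rw [h1, h2, RCLike.inner_apply]
    simp only [map_div₀, map_pow, Complex.conj_ofReal, Complex.star_def]
    ring
  have hi : Integrable (fun z : ℂ => star z ^ n * ((1 : ℂ) * F z)) gaussian := by
    have h2 := (L2.integrable_inner (𝕜 := ℂ) (fockInclusion (monomial n))
      (fockInclusion f)).congr h1
    refine (h2.const_mul (Real.sqrt (n.factorial) : ℂ)).congr (ae_of_all _ fun z => ?_)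
    simp only
    rw [mul_inv_cancel_left₀ (sqrt_factorial_ne_zero n)]
  have h3 := integral_star_pow_mul_radial hF (a := fun _ => 1) measurable_const n hi
  simp only [one_mul] at h3 h1
  rw [integral_complex_ofReal, integral_sqrtGammaDensity] at h3
  rw [← inner_fockInclusion, L2.inner_def, integral_congr_ae h1, integral_const_mul, h3]
  simp

theorem orthonormal_monomial : Orthonormal ℂ monomial := by
  rw [orthonormal_iff_ite]
  intro n m
  rw [inner_monomial n (monomial m) (F := fun z => z ^ m / (Real.sqrt (m.factorial) : ℂ))
    (by fun_prop) (fockInclusion_monomial_ae m), iteratedDeriv_div_const,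
    iteratedDeriv_fun_pow_zero]
  split_ifs with h
  · subst h
    have h1 := sqrt_factorial_ne_zero n
    field_simp
    rw [← Complex.ofReal_pow, Real.sq_sqrt (by positivity)]
    simp
  · simp

theorem eq_zero_of_inner_monomial_eq_zero (f : FockSpace)
    (h : ∀ n, inner ℂ (monomial n) f = 0) : f = 0 := by
  obtain ⟨F, hF, hf⟩ := exists_entire f
  have h1 : ∀ n, iteratedDeriv n F 0 = 0 := fun n => by
    have h2 := h n
    rw [inner_monomial n f hF hf] at h2
    simpa [sqrt_factorial_ne_zero n] using h2
  have h3 : F = 0 := by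
    ext z
    rw [← Complex.taylorSeries_eq_of_entire' 0 z hF]
    simp [h1]
  refine Subtype.ext (Lp.ext (hf.trans ?_))
  rw [h3]
  exact (Lp.coeFn_zero ..).symm

/-- The monomials form a Hilbert basis of the Fock space. -/
def monomialBasis : HilbertBasis ℕ ℂ FockSpace :=
  HilbertBasis.mkOfOrthogonalEqBot orthonormal_monomial (by
    rw [Submodule.eq_bot_iff]
    intro f hf
    refine eq_zero_of_inner_monomial_eq_zero f fun n => ?_
    exact Submodule.mem_orthogonal _ f |>.1 hf _ (Submodule.subset_span ⟨n, rfl⟩))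

theorem coe_monomialBasis : ⇑monomialBasis = monomial :=
  HilbertBasis.coe_mkOfOrthogonalEqBot orthonormal_monomial _

theorem ext_inner_monomial {f g : FockSpace}
    (h : ∀ n, inner ℂ (monomial n) f = inner ℂ (monomial n) g) : f = g := by
  rw [← sub_eq_zero]
  refine eq_zero_of_inner_monomial_eq_zero _ fun n => ?_
  rw [inner_sub_right, h, sub_self]

theorem inner_monomial_toeplitz {φ : LinftyC} {a : LinftyPos} (h : HasRadialProfile φ a) (n : ℕ)
    (f : FockSpace) :
    inner ℂ (monomial n) (toeplitz φ f) = gammaFun a n * inner ℂ (monomial n) f := by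
  obtain ⟨F, hF, hf⟩ := exists_entire f
  rw [inner_monomial n f hF hf, ← inner_monomial_mul_radial h n f hF hf]
  exact inner_bargmannProjection _ _

theorem toeplitz_monomial {φ : LinftyC} {a : LinftyPos} (h : HasRadialProfile φ a) (n : ℕ) :
    toeplitz φ (monomial n) = gammaSeq a n • monomial n := by
  refine ext_inner_monomial fun m => ?_
  rw [inner_monomial_toeplitz h, inner_smul_right, orthonormal_iff_ite.1 orthonormal_monomial]
  change gammaFun a m * _ = gammaFun a n * _
  split_ifs with hmn
  · rw [hmn]
  · simp

/-! ### Diagonal operators and the Toeplitz algebra -/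

theorem norm_mul_le_one : ‖ContinuousLinearMap.mul ℂ ℂ‖ ≤ (1 : NNReal) :=
  ContinuousLinearMap.opNorm_mul_le ℂ ℂ

/-- Multiplication by a bounded sequence on `ℓ²(ℤ₊)`. -/
def sequenceMul (σ : LinftySeq) :
    lp (fun _ : ℕ => ℂ) 2 →L[ℂ] lp (fun _ : ℕ => ℂ) 2 :=
  lp.holderL (p := ∞) (q := 2) 2 (fun _ : ℕ => ContinuousLinearMap.mul ℂ ℂ)
    (fun _ => norm_mul_le_one) σ

theorem sequenceMul_apply (σ : LinftySeq) (x : lp (fun _ : ℕ => ℂ) 2) (n : ℕ) :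
    sequenceMul σ x n = σ n * x n := rfl

theorem norm_sequenceMul_le (σ : LinftySeq) : ‖sequenceMul σ‖ ≤ ‖σ‖ := by
  refine ((lp.holderL (p := ∞) (q := 2) 2 (fun _ : ℕ => ContinuousLinearMap.mul ℂ ℂ)
    (fun _ => norm_mul_le_one)).le_opNorm σ).trans ?_
  refine mul_le_of_le_one_left (norm_nonneg _) ?_
  exact lp.norm_holderL_le (p := ∞) (q := 2) 2 (fun _ : ℕ => ContinuousLinearMap.mul ℂ ℂ)
    (fun _ => norm_mul_le_one)

/-- The operator on the Fock space that is diagonal in the basis of monomials, with the given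
eigenvalues. -/
def diagonalOperator (σ : LinftySeq) : FockSpace →L[ℂ] FockSpace :=
  monomialBasis.repr.symm.toContinuousLinearEquiv.toContinuousLinearMap ∘L
    sequenceMul σ ∘L monomialBasis.repr.toContinuousLinearEquiv.toContinuousLinearMap

theorem diagonalOperator_apply (σ : LinftySeq) (f : FockSpace) :
    diagonalOperator σ f = monomialBasis.repr.symm (sequenceMul σ (monomialBasis.repr f)) := rfl

theorem inner_monomial_diagonalOperator (σ : LinftySeq) (n : ℕ) (f : FockSpace) :
    inner ℂ (monomial n) (diagonalOperator σ f) = σ n * inner ℂ (monomial n) f := by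
  have h : ∀ g, inner ℂ (monomial n) g = monomialBasis.repr g n := fun g => by
    rw [HilbertBasis.repr_apply_apply, coe_monomialBasis]
  rw [h, h, diagonalOperator_apply, LinearIsometryEquiv.apply_symm_apply, sequenceMul_apply]

theorem diagonalOperator_monomial (σ : LinftySeq) (n : ℕ) :
    diagonalOperator σ (monomial n) = σ n • monomial n := by
  refine ext_inner_monomial fun m => ?_
  rw [inner_monomial_diagonalOperator, inner_smul_right,
    orthonormal_iff_ite.1 orthonormal_monomial]
  split_ifs with hmn
  · rw [hmn]
  · simp

theorem norm_diagonalOperator_le (σ : LinftySeq) : ‖diagonalOperator σ‖ ≤ ‖σ‖ := by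
  refine ContinuousLinearMap.opNorm_le_bound _ (norm_nonneg _) fun f => ?_
  rw [diagonalOperator_apply, LinearIsometryEquiv.norm_map]
  refine ((sequenceMul σ).le_of_opNorm_le (norm_sequenceMul_le σ) _).trans_eq ?_
  rw [LinearIsometryEquiv.norm_map]

theorem norm_diagonalOperator (σ : LinftySeq) : ‖diagonalOperator σ‖ = ‖σ‖ := by
  refine le_antisymm (norm_diagonalOperator_le σ) (lp.norm_le_of_forall_le (norm_nonneg _)
    fun n => ?_)
  have h := (diagonalOperator σ).le_opNorm (monomial n)
  rwa [diagonalOperator_monomial, norm_smul, orthonormal_monomial.1, mul_one, mul_one] at h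

/-- The *-homomorphism sending a bounded sequence to the operator that is diagonal in the basis of
monomials. -/
def diagonalHom : LinftySeq →⋆ₐ[ℂ] (FockSpace →L[ℂ] FockSpace) where
  toFun := diagonalOperator
  map_one' := by
    ext1 f
    exact ext_inner_monomial fun n => by simp [inner_monomial_diagonalOperator]
  map_mul' σ τ := by
    ext1 f
    exact ext_inner_monomial fun n => by
      simp [inner_monomial_diagonalOperator, mul_assoc]
  map_zero' := by
    ext1 f
    exact ext_inner_monomial fun n => by simp [inner_monomial_diagonalOperator]
  map_add' σ τ := by
    ext1 f
    exact ext_inner_monomial fun n => by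
      simp [inner_monomial_diagonalOperator, add_mul]
  commutes' c := by
    ext1 f
    exact ext_inner_monomial fun n => by
      simp [inner_monomial_diagonalOperator, Algebra.algebraMap_eq_smul_one]
  map_star' σ := by
    ext1 f
    refine ext_inner_monomial fun n => ?_
    rw [inner_monomial_diagonalOperator, ContinuousLinearMap.star_eq_adjoint,
      ContinuousLinearMap.adjoint_inner_right, diagonalOperator_monomial, inner_smul_left]
    rfl

theorem isometry_diagonalHom : Isometry diagonalHom :=
  AddMonoidHomClass.isometry_of_norm diagonalHom norm_diagonalOperator

theorem toeplitz_eq_diagonalHom {φ : LinftyC} {a : LinftyPos} (h : HasRadialProfile φ a) :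
    toeplitz φ = diagonalHom (gammaSeq a) := by
  ext1 f
  refine ext_inner_monomial fun n => ?_
  rw [inner_monomial_toeplitz h]
  exact (inner_monomial_diagonalOperator (gammaSeq a) n f).symm

/-- The generators correspond because every profile comes from a symbol. The closures correspond
because an isometry of a complete space is a closed map. -/
theorem radialToeplitzAlgebra_eq_map : radialToeplitzAlgebra = eigenAlgebra.map diagonalHom := by
  have h : {T | ∃ φ, IsRadialSymbol φ ∧ toeplitz φ = T} = diagonalHom '' eigenSequences := by
    ext T
    constructor
    · rintro ⟨φ, ⟨a, ha⟩, rfl⟩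
      exact ⟨_, ⟨a, rfl⟩, (toeplitz_eq_diagonalHom ha).symm⟩
    · rintro ⟨_, ⟨a, rfl⟩, rfl⟩
      obtain ⟨φ, hφ⟩ := exists_hasRadialProfile a
      exact ⟨φ, ⟨a, hφ⟩, toeplitz_eq_diagonalHom hφ⟩
  rw [radialToeplitzAlgebra, eigenAlgebra, h, ← StarAlgHom.map_adjoin]
  exact StarSubalgebra.topologicalClosure_map _ _ isometry_diagonalHom.isClosedEmbedding.isClosedMap
    isometry_diagonalHom.continuous

/-- Φ is the inverse of `diagonalHom` restricted to S, which is an isometric bijection onto its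
image. -/
theorem exists_starAlgEquiv_of_map {S : StarSubalgebra ℂ LinftySeq}
    {A : StarSubalgebra ℂ (FockSpace →L[ℂ] FockSpace)} (h : A = S.map diagonalHom) :
    ∃ Φ : A ≃⋆ₐ[ℂ] S, Isometry Φ ∧ ∀ (T : A) (n : ℕ),
      (T : FockSpace →L[ℂ] FockSpace) (monomial n) = (Φ T : LinftySeq) n • monomial n := by
  subst h
  let ψ : S →⋆ₐ[ℂ] S.map diagonalHom :=
    (diagonalHom.comp S.subtype).codRestrict _ fun x => ⟨x, x.2, rfl⟩
  have hψ : Isometry ψ := fun x y => isometry_diagonalHom (x : LinftySeq) y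
  have hs : Function.Surjective ψ := by
    rintro ⟨_, x, hx, rfl⟩
    exact ⟨⟨x, hx⟩, rfl⟩
  let Ψ : S ≃⋆ₐ[ℂ] S.map diagonalHom :=
    { Equiv.ofBijective ψ ⟨hψ.injective, hs⟩ with
      map_mul' := map_mul ψ
      map_add' := map_add ψ
      map_star' := map_star ψ
      map_smul' := map_smul ψ }
  refine ⟨Ψ.symm, ?_, fun T n => ?_⟩
  · exact hψ.right_inv fun T => Ψ.apply_symm_apply T
  · obtain ⟨x, rfl⟩ := Ψ.surjective T
    have h : Ψ.symm (Ψ x) = x := Ψ.symm_apply_apply x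
    change diagonalOperator x (monomial n) = (Ψ.symm (Ψ x) : LinftySeq) n • monomial n
    rw [h]
    exact diagonalOperator_monomial x n

/-! ### Gaussian limit of the centred densities -/

/-- **Scheffé's lemma**. -/
theorem tendsto_integral_abs_sub_of_tendsto {α : Type*} [MeasurableSpace α] {μ : Measure α}
    {f : ℕ → α → ℝ} {g : α → ℝ} (hf : ∀ n, Integrable (f n) μ) (hg : Integrable g μ)
    (hf0 : ∀ n x, 0 ≤ f n x) (hfg : ∀ n, ∫ x, f n x ∂μ = ∫ x, g x ∂μ)
    (h : ∀ x, Tendsto (fun n => f n x) atTop (𝓝 (g x))) :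
    Tendsto (fun n => ∫ x, |f n x - g x| ∂μ) atTop (𝓝 0) := by
  -- Equal total masses reduce the L¹ distance to the positive part of g - f_n, which is dominated
  -- by |g|.
  have h1 : ∀ n, ∫ x, |f n x - g x| ∂μ = 2 * ∫ x, max (g x - f n x) 0 ∂μ := by
    intro n
    have h2 : ∀ x, |f n x - g x| = 2 * max (g x - f n x) 0 + (f n x - g x) := by
      intro x
      rcases le_total (g x) (f n x) with h | h
      · rw [abs_of_nonneg (by linarith), max_eq_right (by linarith)]; ring
      · rw [abs_of_nonpos (by linarith), max_eq_left (by linarith)]; ring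
    have hp : Integrable (fun x => max (g x - f n x) 0) μ := (hg.sub (hf n)).pos_part
    have hq : Integrable (fun x => f n x - g x) μ := (hf n).sub hg
    simp_rw [h2]
    rw [integral_add (hp.const_mul 2) hq, integral_sub (hf n) hg, hfg,
      integral_const_mul]
    ring
  simp_rw [h1]
  have h3 : Tendsto (fun n => ∫ x, max (g x - f n x) 0 ∂μ) atTop (𝓝 (∫ _, (0 : ℝ) ∂μ)) := by
    refine tendsto_integral_of_dominated_convergence (fun x => |g x|)
      (fun n => (hg.sub (hf n)).pos_part.aestronglyMeasurable) hg.abs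
      (fun n => ae_of_all _ fun x => ?_) (ae_of_all _ fun x => ?_)
    · rw [Real.norm_of_nonneg (le_max_right _ _)]
      exact max_le ((by linarith [hf0 n x] : g x - f n x ≤ g x).trans (le_abs_self _))
        (abs_nonneg _)
    · have h4 := ((tendsto_const_nhds (x := g x)).sub (h x)).max (tendsto_const_nhds (x := (0 : ℝ)))
      simpa using h4
  simpa using h3.const_mul 2

/-- Second-order expansion of the logarithm: the remainder is at most |y/s|³/(1 - |y/s|), still
vanishing after multiplication by 2s². This is the exponent occurring in
`sqrtGammaDensity_sqrt_add`. -/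
theorem tendsto_two_mul_log_sub (y : ℝ) :
    Tendsto (fun s : ℝ => 2 * s ^ 2 * Real.log (1 + y / s) - 2 * s * y) atTop (𝓝 (-y ^ 2)) := by
  have h0 : Tendsto (fun s : ℝ => y / s) atTop (𝓝 0) := tendsto_const_nhds.div_atTop tendsto_id
  have hlim : Tendsto (fun s : ℝ => 2 * y ^ 2 * (|y / s| / (1 - |y / s|))) atTop (𝓝 0) := by
    have h1 : Tendsto (fun s : ℝ => |y / s|) atTop (𝓝 0) := by simpa using h0.abs
    have h2 := (h1.div (tendsto_const_nhds (x := (1 : ℝ)) |>.sub h1) (by simp)).const_mul (2 * y ^ 2)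
    simpa using h2
  rw [tendsto_iff_norm_sub_tendsto_zero]
  refine squeeze_zero' (Eventually.of_forall fun s => norm_nonneg _) ?_ hlim
  have hlt : ∀ᶠ s : ℝ in atTop, |y / s| < 1 := by
    have h1 : Tendsto (fun s : ℝ => |y / s|) atTop (𝓝 0) := by simpa using h0.abs
    exact h1.eventually_lt_const one_pos
  filter_upwards [hlt, eventually_gt_atTop 0] with s hs hs0
  have h1 := Real.abs_log_sub_add_sum_range_le (x := -(y / s)) (by rwa [abs_neg]) 2
  rw [abs_neg] at h1
  simp only [Finset.sum_range_succ, Finset.sum_range_zero] at h1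
  have h2 : 2 * s ^ 2 * Real.log (1 + y / s) - 2 * s * y - -y ^ 2 = 2 * s ^ 2 *
      (0 + (-(y / s)) ^ (0 + 1) / ((0 : ℕ) + 1) + (-(y / s)) ^ (1 + 1) / ((1 : ℕ) + 1)
        + Real.log (1 - -(y / s))) := by
    rw [sub_neg_eq_add]
    push_cast
    field_simp
    ring_nf
  rw [h2, norm_mul, Real.norm_of_nonneg (by positivity), Real.norm_eq_abs]
  refine (mul_le_mul_of_nonneg_left h1 (by positivity)).trans_eq ?_
  have h3 : |y / s| ^ (2 + 1) = |y / s| * (y ^ 2 / s ^ 2) := by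
    rw [pow_succ', sq_abs, div_pow]
  rw [h3]
  field_simp

/-- The density of the law of `√r - √n` when `r` has the law `e^{-r} rⁿ / n!`. -/
def centredDensity (n : ℕ) (y : ℝ) : ℝ :=
  (Set.Ioi (0 : ℝ)).indicator (sqrtGammaDensity n) (Real.sqrt n + y)

theorem centredDensity_nonneg (n : ℕ) (y : ℝ) : 0 ≤ centredDensity n y :=
  Set.indicator_nonneg (fun _ hx => sqrtGammaDensity_nonneg n (le_of_lt hx)) _

theorem integrable_centredDensity (n : ℕ) : Integrable (centredDensity n) :=
  ((integrableOn_sqrtGammaDensity n).integrable_indicator measurableSet_Ioi).comp_add_left _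

theorem integral_centredDensity (n : ℕ) : ∫ y, centredDensity n y = 1 := by
  unfold centredDensity
  rw [integral_add_left_eq_self, integral_indicator measurableSet_Ioi, integral_sqrtGammaDensity]

/-- An exact identity: the factorial is absorbed into `Stirling.stirlingSeq`, so that each factor
has an evident limit. -/
theorem sqrtGammaDensity_sqrt_add {n : ℕ} (hn : n ≠ 0) {y : ℝ} (hy : 0 < 1 + y / Real.sqrt n) :
    sqrtGammaDensity n (Real.sqrt n + y) = Real.sqrt 2 / Stirling.stirlingSeq n *
      (1 + y / Real.sqrt n) * Real.exp (2 * Real.sqrt n ^ 2 * Real.log (1 + y / Real.sqrt n)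
        - 2 * Real.sqrt n * y) * Real.exp (-y ^ 2) := by
  have hn0 : (0 : ℝ) < n := by positivity
  set s := Real.sqrt n with hs
  have hs0 : 0 < s := Real.sqrt_pos.2 hn0
  have hs2 : s ^ 2 = n := Real.sq_sqrt hn0.le
  have hfac : (n.factorial : ℝ) = Stirling.stirlingSeq n * (Real.sqrt 2 * s * (s ^ (2 * n) *
      Real.exp (-s ^ 2))) := by
    have h2 : (0 : ℝ) < Real.sqrt 2 := by positivity
    rw [Stirling.stirlingSeq, Real.sqrt_mul (by norm_num), ← hs, div_pow, pow_mul, hs2,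
      ← Real.exp_nat_mul, mul_one, Real.exp_neg]
    field_simp
  have hS : Stirling.stirlingSeq n ≠ 0 := by
    intro h
    rw [h, zero_mul] at hfac
    exact n.factorial_ne_zero (by exact_mod_cast hfac)
  have h1 : s + y = s * (1 + y / s) := by field_simp
  have h2 : Real.exp (2 * s ^ 2 * Real.log (1 + y / s) - 2 * s * y) =
      (1 + y / s) ^ (2 * n) * Real.exp (-(2 * s * y)) := by
    rw [sub_eq_add_neg, Real.exp_add, hs2]
    congr 1
    rw [← Real.exp_log (pow_pos hy (2 * n)), Real.log_pow]
    push_cast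
    rfl
  have h3 : Real.exp (-(s + y) ^ 2) =
      Real.exp (-s ^ 2) * Real.exp (-(2 * s * y)) * Real.exp (-y ^ 2) := by
    rw [← Real.exp_add, ← Real.exp_add]
    congr 1
    ring
  rw [sqrtGammaDensity, h2, h3, hfac, h1, mul_pow]
  have h5 : (0 : ℝ) < Real.sqrt 2 := by positivity
  have h6 := Real.exp_pos (-s ^ 2)
  generalize 1 + y / s = u at *
  field_simp
  rw [Real.sq_sqrt (by norm_num)]
  ring

theorem tendsto_centredDensity (y : ℝ) :
    Tendsto (fun n => centredDensity n y) atTop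
      (𝓝 (ProbabilityTheory.gaussianPDFReal 0 (1 / 4) y)) := by
  have hs : Tendsto (fun n : ℕ => Real.sqrt n) atTop atTop :=
    Real.tendsto_sqrt_atTop.comp tendsto_natCast_atTop_atTop
  have h0 : Tendsto (fun n : ℕ => 1 + y / Real.sqrt n) atTop (𝓝 1) := by
    have := (tendsto_const_nhds (x := y)).div_atTop hs
    simpa using this.const_add 1
  have h1 := ((((tendsto_const_nhds (x := Real.sqrt 2)).div Stirling.tendsto_stirlingSeq_sqrt_pi
    (by positivity)).mul h0).mul
    ((Real.continuous_exp.tendsto _).comp ((tendsto_two_mul_log_sub y).comp hs))).mul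
    (tendsto_const_nhds (x := Real.exp (-y ^ 2)))
  -- One factor exp(-y²) comes from the logarithm and one from the density; exp(-2y²) has variance
  -- 1/4.
  have h2 : Real.sqrt 2 / Real.sqrt Real.pi * 1 * Real.exp (-y ^ 2) * Real.exp (-y ^ 2) =
      ProbabilityTheory.gaussianPDFReal 0 (1 / 4) y := by
    rw [ProbabilityTheory.gaussianPDFReal, mul_assoc, ← Real.exp_add, mul_one]
    have h3 : -y ^ 2 + -y ^ 2 = -(y - 0) ^ 2 / (2 * ((1 / 4 : NNReal) : ℝ)) := by
      push_cast
      ring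
    have h4 : Real.sqrt 2 / Real.sqrt Real.pi = (Real.sqrt (2 * Real.pi * (1 / 4 : NNReal)))⁻¹ := by
      rw [← Real.sqrt_div (by norm_num), ← Real.sqrt_inv]
      congr 1
      push_cast
      field_simp
      norm_num
    rw [h3, h4]
  rw [h2] at h1
  refine h1.congr' ?_
  filter_upwards [h0.eventually_const_lt one_half_lt_one, eventually_ne_atTop 0] with n hn hn0
  have hpos : 0 < 1 + y / Real.sqrt n := by linarith
  have hs0 : 0 < Real.sqrt n := Real.sqrt_pos.2 (by positivity)
  have hmem : Real.sqrt n + y ∈ Set.Ioi (0 : ℝ) := by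
    have : Real.sqrt n + y = Real.sqrt n * (1 + y / Real.sqrt n) := by field_simp
    rw [Set.mem_Ioi, this]
    positivity
  rw [centredDensity, Set.indicator_of_mem hmem, sqrtGammaDensity_sqrt_add hn0 hpos]
  rfl

theorem tendsto_integral_abs_centredDensity_sub :
    Tendsto (fun n => ∫ y, |centredDensity n y - ProbabilityTheory.gaussianPDFReal 0 (1 / 4) y|)
      atTop (𝓝 0) :=
  tendsto_integral_abs_sub_of_tendsto integrable_centredDensity
    (ProbabilityTheory.integrable_gaussianPDFReal _ _) centredDensity_nonneg
    (fun n => by rw [integral_centredDensity,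
      ProbabilityTheory.integral_gaussianPDFReal_eq_one _ (by norm_num)])
    tendsto_centredDensity

/-! ### Eigenvalue sequences as sampled Gaussian convolutions -/

/-- The class of a bounded measurable function on the half-line. -/
def boundedProfile {α : ℝ → ℂ} (hα : Measurable α) {C : ℝ} (hC : ∀ x, ‖α x‖ ≤ C) : LinftyPos :=
  (memLp_top_of_bound hα.aestronglyMeasurable C (ae_of_all _ hC)).toLp

theorem gammaFun_boundedProfile {α : ℝ → ℂ} (hα : Measurable α) {C : ℝ} (hC : ∀ x, ‖α x‖ ≤ C)
    (n : ℕ) :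
    gammaFun (boundedProfile hα hC) n =
      ∫ x in Set.Ioi (0 : ℝ), α x * (sqrtGammaDensity n x : ℂ) := by
  rw [gammaFun_eq]
  refine integral_congr_ae ?_
  filter_upwards [MemLp.coeFn_toLp (memLp_top_of_bound (μ := (volume : Measure ℝ).restrict
    (Set.Ioi 0)) hα.aestronglyMeasurable C (ae_of_all _ hC))] with x hx
  rw [boundedProfile, hx]

theorem gammaFun_boundedProfile_eq_integral_centredDensity {α : ℝ → ℂ} (hα : Measurable α) {C : ℝ}
    (hC : ∀ x, ‖α x‖ ≤ C) (n : ℕ) :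
    gammaFun (boundedProfile hα hC) n = ∫ y, α (Real.sqrt n + y) * (centredDensity n y : ℂ) := by
  rw [gammaFun_boundedProfile, ← integral_indicator measurableSet_Ioi,
    ← integral_add_left_eq_self _ (Real.sqrt n)]
  refine integral_congr_ae (ae_of_all _ fun y => ?_)
  simp only [centredDensity, Set.indicator]
  split_ifs <;> simp

/-- The error is at most C times the L¹ distance of the centred density from the Gaussian, whatever
the translate of α. -/
theorem tendsto_gammaFun_sub_integral_gaussian {α : ℝ → ℂ} (hα : Measurable α) {C : ℝ}
    (hC : ∀ x, ‖α x‖ ≤ C) :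
    Tendsto (fun n : ℕ => gammaFun (boundedProfile hα hC) n -
      ∫ y, α (Real.sqrt n + y) * (ProbabilityTheory.gaussianPDFReal 0 (1 / 4) y : ℂ))
      atTop (𝓝 0) := by
  have h1 := tendsto_integral_abs_centredDensity_sub.const_mul C
  rw [mul_zero] at h1
  refine squeeze_zero_norm (fun n => ?_) h1
  have hm : AEStronglyMeasurable (fun y => α (Real.sqrt n + y)) :=
    (hα.comp (measurable_const_add _)).aestronglyMeasurable
  have hb : ∀ᵐ y : ℝ, ‖α (Real.sqrt n + y)‖ ≤ C := ae_of_all _ fun y => hC _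
  have hG := ProbabilityTheory.integrable_gaussianPDFReal 0 (1 / 4)
  have hI1 : Integrable fun y => α (Real.sqrt n + y) * (centredDensity n y : ℂ) :=
    (integrable_centredDensity n).ofReal.bdd_mul hm hb
  have hI2 : Integrable fun y => α (Real.sqrt n + y) *
      (ProbabilityTheory.gaussianPDFReal 0 (1 / 4) y : ℂ) := hG.ofReal.bdd_mul hm hb
  rw [gammaFun_boundedProfile_eq_integral_centredDensity, ← integral_sub hI1 hI2,
    ← integral_const_mul]
  refine norm_integral_le_of_norm_le
    (((integrable_centredDensity n).sub hG).abs.const_mul C) (ae_of_all _ fun y => ?_)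
  rw [← mul_sub, norm_mul, ← Complex.ofReal_sub, Complex.norm_real, Real.norm_eq_abs]
  exact mul_le_mul_of_nonneg_right (hC _) (abs_nonneg _)

theorem gammaFun_add (a b : LinftyPos) (n : ℕ) :
    gammaFun (a + b) n = gammaFun a n + gammaFun b n := by
  rw [gammaFun_eq, gammaFun_eq, gammaFun_eq, ← integral_add (integrableOn_mul_sqrtGammaDensity a n)
    (integrableOn_mul_sqrtGammaDensity b n)]
  refine integral_congr_ae ?_
  filter_upwards [Lp.coeFn_add a b] with x hx
  rw [hx, Pi.add_apply, add_mul]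

theorem gammaFun_smul (c : ℂ) (a : LinftyPos) (n : ℕ) :
    gammaFun (c • a) n = c * gammaFun a n := by
  rw [gammaFun_eq, gammaFun_eq, ← integral_const_mul]
  refine integral_congr_ae ?_
  filter_upwards [Lp.coeFn_smul c a] with x hx
  rw [hx, Pi.smul_apply, smul_eq_mul, mul_assoc]

/-! ### The uniform closure of 𝔊 contains the null sequences -/

/-- The map `a ↦ γ_a` as a linear map. -/
def gammaLinear : LinftyPos →ₗ[ℂ] LinftySeq where
  toFun := gammaSeq
  map_add' a b := lp.ext (funext fun n => gammaFun_add a b n)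
  map_smul' c a := lp.ext (funext fun n => gammaFun_smul c a n)

/-- The uniform closure of the space of eigenvalue sequences. -/
def eigenClosure : Submodule ℂ LinftySeq :=
  (LinearMap.range gammaLinear).topologicalClosure

theorem coe_eigenClosure : (eigenClosure : Set LinftySeq) = closure eigenSequences := rfl

theorem gammaSeq_mem_eigenClosure (a : LinftyPos) : gammaSeq a ∈ eigenClosure :=
  subset_closure (s := eigenSequences) ⟨a, rfl⟩

/-- The sequences underlying the elements of the uniform closure of the eigenvalue sequences. -/
def eigenClosureFun : Submodule ℂ (ℕ → ℂ) where
  carrier := {s | ∃ x ∈ eigenClosure, ⇑x = s}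
  add_mem' := by
    rintro _ _ ⟨x, hx, rfl⟩ ⟨y, hy, rfl⟩
    exact ⟨x + y, add_mem hx hy, rfl⟩
  zero_mem' := ⟨0, zero_mem _, rfl⟩
  smul_mem' := by
    rintro c _ ⟨x, hx, rfl⟩
    exact ⟨c • x, eigenClosure.smul_mem c hx, rfl⟩

theorem coe_mem_eigenClosureFun {x : LinftySeq} : ⇑x ∈ eigenClosureFun ↔ x ∈ eigenClosure :=
  ⟨fun ⟨_, hy, h⟩ => lp.ext h ▸ hy, fun h => ⟨x, h, rfl⟩⟩

theorem gammaFun_mem_eigenClosureFun (a : LinftyPos) : gammaFun a ∈ eigenClosureFun :=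
  ⟨gammaSeq a, gammaSeq_mem_eigenClosure a, rfl⟩

theorem mem_eigenClosureFun_of_approx {s : ℕ → ℂ}
    (h : ∀ ε > 0, ∃ t ∈ eigenClosureFun, ∀ n, ‖s n - t n‖ ≤ ε) : s ∈ eigenClosureFun := by
  have hs : Memℓp s ∞ := by
    obtain ⟨_, ⟨x, -, rfl⟩, ht⟩ := h 1 one_pos
    refine memℓp_infty ⟨1 + ‖x‖, ?_⟩
    rintro _ ⟨n, rfl⟩
    have h1 := norm_le_norm_add_norm_sub' (s n) (x n)
    have h2 := lp.norm_apply_le_norm (by simp) x n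
    linarith [ht n]
  refine ⟨⟨s, hs⟩, ?_, rfl⟩
  have hc : IsClosed (eigenClosure : Set LinftySeq) := isClosed_closure
  rw [← SetLike.mem_coe, ← hc.closure_eq]
  refine Metric.mem_closure_iff.2 fun ε hε => ?_
  obtain ⟨_, ⟨x, hx, rfl⟩, ht⟩ := h (ε / 2) (by positivity)
  refine ⟨x, hx, lt_of_le_of_lt ?_ (half_lt_self hε)⟩
  rw [dist_eq_norm]
  exact lp.norm_le_of_forall_le (by positivity) ht

/-- The profile exp(-(1/z - 1)x²) merely rescales the exponential in the density, which multiplies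
the integral by z^{n+1}. -/
theorem pow_succ_mem_eigenClosureFun {z : ℝ} (h0 : 0 < z) (h1 : z ≤ 1) :
    (fun n => (z : ℂ) ^ (n + 1)) ∈ eigenClosureFun := by
  set lam := z⁻¹ - 1 with hlam
  have hl : 0 ≤ lam := sub_nonneg.2 (one_le_inv_iff₀.2 ⟨h0, h1⟩)
  have hb : ∀ x : ℝ, ‖((Real.exp (-lam * x ^ 2) : ℝ) : ℂ)‖ ≤ 1 := fun x => by
    rw [Complex.norm_real, Real.norm_of_nonneg (Real.exp_pos _).le, Real.exp_le_one_iff]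
    nlinarith [mul_nonneg hl (sq_nonneg x)]
  have hm : Measurable fun x : ℝ => ((Real.exp (-lam * x ^ 2) : ℝ) : ℂ) := by fun_prop
  convert gammaFun_mem_eigenClosureFun (boundedProfile hm hb) using 1
  ext n
  have h2 : ∀ x : ℝ, ((Real.exp (-lam * x ^ 2) : ℝ) : ℂ) * (sqrtGammaDensity n x : ℂ) =
      (((2 / n.factorial) * (x ^ (2 * n + 1) * Real.exp (-z⁻¹ * x ^ 2)) : ℝ) : ℂ) := fun x => by
    have h3 : -z⁻¹ * x ^ 2 = -lam * x ^ 2 + -x ^ 2 := by rw [hlam]; ring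
    rw [← Complex.ofReal_mul, sqrtGammaDensity, h3, Real.exp_add]
    congr 1
    ring
  rw [gammaFun_boundedProfile]
  simp_rw [h2]
  rw [integral_complex_ofReal, integral_const_mul, integral_Ioi_pow_mul_exp n (inv_pos.2 h0),
    ← Complex.ofReal_pow, inv_pow]
  congr 1
  have := n.factorial_ne_zero
  field_simp

/-- Remove the entries before k from a geometric sequence, using the unit vectors already obtained,
and divide by z^{k+1}: entry k is 1 and all later ones are at most z, which is taken small. -/
theorem single_mem_eigenClosureFun (k : ℕ) : (Pi.single k 1 : ℕ → ℂ) ∈ eigenClosureFun := by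
  induction k using Nat.strong_induction_on with
  | _ k ih =>
    refine mem_eigenClosureFun_of_approx fun ε hε => ?_
    set z := min ε 1 with hz
    have hz0 : 0 < z := lt_min hε one_pos
    have hz1 : z ≤ 1 := min_le_right _ _
    have hzε : z ≤ ε := min_le_left _ _
    have hzc : (z : ℂ) ≠ 0 := by exact_mod_cast hz0.ne'
    refine ⟨((z : ℂ) ^ (k + 1))⁻¹ • ((fun n => (z : ℂ) ^ (n + 1)) -
      ∑ j ∈ Finset.range k, (z : ℂ) ^ (j + 1) • (Pi.single j 1 : ℕ → ℂ)), ?_, fun n => ?_⟩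
    · refine eigenClosureFun.smul_mem _ (sub_mem (pow_succ_mem_eigenClosureFun hz0 hz1) ?_)
      exact sum_mem fun j hj => eigenClosureFun.smul_mem _ (ih j (Finset.mem_range.1 hj))
    · have hsum : (∑ j ∈ Finset.range k, (z : ℂ) ^ (j + 1) • (Pi.single j 1 : ℕ → ℂ)) n =
          if n < k then (z : ℂ) ^ (n + 1) else 0 := by
        simp [Finset.sum_apply, Pi.single_apply, Finset.sum_ite_eq]
      rw [Pi.smul_apply, Pi.sub_apply, hsum, smul_eq_mul]
      rcases lt_trichotomy n k with h | h | h
      · simp [h, h.ne, hε.le]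
      · subst h
        simp [hzc, hε.le]
      · obtain ⟨m, rfl⟩ := Nat.exists_eq_add_of_lt h
        have h1 : ((z : ℂ) ^ (k + 1))⁻¹ * (z : ℂ) ^ (k + m + 1 + 1) = ((z ^ (m + 1) : ℝ) : ℂ) := by
          push_cast
          field_simp
          ring
        have h2 : ¬ (k + m + 1 < k) := by omega
        have h3 : k + m + 1 ≠ k := by omega
        rw [if_neg h2, sub_zero, h1, Pi.single_eq_of_ne h3, zero_sub, norm_neg, Complex.norm_real,
          Real.norm_of_nonneg (by positivity)]
        exact (pow_le_of_le_one hz0.le hz1 (by omega)).trans hzε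

theorem mem_eigenClosureFun_of_tendsto_zero {s : ℕ → ℂ} (h : Tendsto s atTop (𝓝 0)) :
    s ∈ eigenClosureFun := by
  refine mem_eigenClosureFun_of_approx fun ε hε => ?_
  obtain ⟨N, hN⟩ := Metric.tendsto_atTop.1 h ε hε
  refine ⟨∑ j ∈ Finset.range N, s j • (Pi.single j 1 : ℕ → ℂ),
    sum_mem fun j _ => eigenClosureFun.smul_mem _ (single_mem_eigenClosureFun j), fun n => ?_⟩
  have hsum : (∑ j ∈ Finset.range N, s j • (Pi.single j 1 : ℕ → ℂ)) n =
      if n < N then s n else 0 := by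
    simp [Finset.sum_apply, Pi.single_apply, Finset.sum_ite_eq]
  rw [hsum]
  split_ifs with hn
  · simpa using hε.le
  · have := hN n (not_lt.1 hn)
    simpa using this.le

theorem mem_eigenClosureFun_of_tendsto_sub {s t : ℕ → ℂ} (ht : t ∈ eigenClosureFun)
    (h : Tendsto (fun n => t n - s n) atTop (𝓝 0)) : s ∈ eigenClosureFun := by
  have h1 := sub_mem ht (mem_eigenClosureFun_of_tendsto_zero h)
  convert h1 using 1
  ext n
  simp

/-- Finitely many entries can be altered at no cost, so only the behaviour for large n matters from
here on. -/
theorem mem_eigenClosureFun_of_eventually_approx {s : ℕ → ℂ}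
    (h : ∀ ε > 0, ∃ t ∈ eigenClosureFun, ∀ᶠ n in atTop, ‖s n - t n‖ ≤ ε) :
    s ∈ eigenClosureFun := by
  refine mem_eigenClosureFun_of_approx fun ε hε => ?_
  obtain ⟨t, ht, h1⟩ := h ε hε
  obtain ⟨N, hN⟩ := eventually_atTop.1 h1
  refine ⟨fun n => if n < N then s n else t n, mem_eigenClosureFun_of_tendsto_sub ht ?_,
    fun n => ?_⟩
  · refine tendsto_const_nhds.congr' ?_
    filter_upwards [eventually_ge_atTop N] with n hn
    simp [not_lt.2 hn]
  · dsimp only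
    split_ifs with hn
    · simpa using hε.le
    · exact hN n (not_lt.1 hn)

/-! ### Gaussian kernels of every width -/

open ProbabilityTheory in
theorem integral_gaussianReal_mem_eigenClosureFun {g : ℝ → ℂ} (hg : Measurable g) {C : ℝ}
    (hC : ∀ x, ‖g x‖ ≤ C) (u : NNReal) :
    (fun n : ℕ => ∫ y, g (Real.sqrt n + y) ∂gaussianReal 0 (1 / 4 + u)) ∈ eigenClosureFun := by
  -- The profile carries a blur of variance u and the asymptotics add 1/4; variances add under
  -- convolution.
  set α : ℝ → ℂ := fun x => ∫ z, g (x + z) ∂gaussianReal 0 u with hα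
  have hm : Measurable α :=
    ((hg.comp measurable_add).stronglyMeasurable.integral_prod_right').measurable
  have hb : ∀ x, ‖α x‖ ≤ C := fun x => by
    refine (norm_integral_le_of_norm_le_const (ae_of_all _ fun z => hC (x + z))).trans ?_
    simp
  refine mem_eigenClosureFun_of_tendsto_sub (gammaFun_mem_eigenClosureFun (boundedProfile hm hb)) ?_
  refine (tendsto_gammaFun_sub_integral_gaussian hm hb).congr fun n => ?_
  congr 1
  have hi : Integrable (fun y => g (Real.sqrt n + y))
      (gaussianReal 0 (1 / 4) ∗ gaussianReal 0 u) :=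
    Integrable.of_bound (hg.comp (measurable_const_add _)).aestronglyMeasurable C
      (ae_of_all _ fun y => hC _)
  have h1 : gaussianReal 0 (1 / 4 + u) = gaussianReal 0 (1 / 4) ∗ gaussianReal 0 u := by
    rw [gaussianReal_conv_gaussianReal, add_zero]
  rw [h1, integral_conv hi, integral_gaussianReal_eq_integral_smul (by norm_num)]
  refine integral_congr_ae (ae_of_all _ fun y => ?_)
  simp only [hα, Complex.real_smul, add_assoc]
  ring

/-- The kernels `k ∈ L¹(ℝ)` for which the sequence `n ↦ ∫ g(√n + y) k(y) dy` is a uniform limit of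
eigenvalue sequences. -/
def admissibleKernels (g : ℝ → ℂ) : Set (ℝ → ℝ) :=
  {k | Integrable k ∧ (fun n : ℕ => ∫ y, g (Real.sqrt n + y) * (k y : ℂ)) ∈ eigenClosureFun}

section Kernels

variable {g : ℝ → ℂ} {C : ℝ}

theorem integrable_shift_mul (hg : Measurable g) (hC : ∀ x, ‖g x‖ ≤ C) {k : ℝ → ℝ}
    (hk : Integrable k) (x : ℝ) : Integrable fun y => g (x + y) * (k y : ℂ) :=
  hk.ofReal.bdd_mul (hg.comp (measurable_const_add _)).aestronglyMeasurable
    (ae_of_all _ fun _ => hC _)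

theorem zero_mem_admissibleKernels : (fun _ => 0) ∈ admissibleKernels g :=
  ⟨integrable_zero _ _ _, by
    simp only [Complex.ofReal_zero, mul_zero, integral_zero]
    exact eigenClosureFun.zero_mem⟩

theorem add_mem_admissibleKernels (hg : Measurable g) (hC : ∀ x, ‖g x‖ ≤ C) {k l : ℝ → ℝ}
    (hk : k ∈ admissibleKernels g) (hl : l ∈ admissibleKernels g) :
    (fun y => k y + l y) ∈ admissibleKernels g := by
  refine ⟨hk.1.add hl.1, ?_⟩
  convert add_mem hk.2 hl.2 using 1
  ext n
  rw [Pi.add_apply, ← integral_add (integrable_shift_mul hg hC hk.1 _)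
    (integrable_shift_mul hg hC hl.1 _)]
  refine integral_congr_ae (ae_of_all _ fun y => ?_)
  push_cast
  ring

theorem const_mul_mem_admissibleKernels {k : ℝ → ℝ} (hk : k ∈ admissibleKernels g) (c : ℝ) :
    (fun y => c * k y) ∈ admissibleKernels g := by
  refine ⟨hk.1.const_mul c, ?_⟩
  convert eigenClosureFun.smul_mem (c : ℂ) hk.2 using 1
  ext n
  rw [Pi.smul_apply, smul_eq_mul, ← integral_const_mul]
  refine integral_congr_ae (ae_of_all _ fun y => ?_)
  push_cast
  ring

theorem sum_mem_admissibleKernels (hg : Measurable g) (hC : ∀ x, ‖g x‖ ≤ C) {k : ℕ → ℝ → ℝ}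
    (hk : ∀ i, k i ∈ admissibleKernels g) (N : ℕ) :
    (fun y => ∑ i ∈ Finset.range N, k i y) ∈ admissibleKernels g := by
  induction N with
  | zero => simpa using zero_mem_admissibleKernels
  | succ N ih =>
    simp only [Finset.sum_range_succ]
    exact add_mem_admissibleKernels hg hC ih (hk N)

/-- Since g is bounded by C, the sequences of two kernels differ uniformly in n by at most C times
their L¹ distance, and domination gives L¹ convergence. -/
theorem mem_admissibleKernels_of_tendsto (hg : Measurable g) (hC : ∀ x, ‖g x‖ ≤ C)
    {k : ℕ → ℝ → ℝ} {l b : ℝ → ℝ} (hk : ∀ i, k i ∈ admissibleKernels g) (hl : Integrable l)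
    (hb : Integrable b) (hkb : ∀ i y, |k i y - l y| ≤ b y)
    (h : ∀ y, Tendsto (fun i => k i y) atTop (𝓝 (l y))) : l ∈ admissibleKernels g := by
  refine ⟨hl, mem_eigenClosureFun_of_approx fun ε hε => ?_⟩
  have h1 : Tendsto (fun i => C * ∫ y, |k i y - l y|) atTop (𝓝 (C * ∫ _ : ℝ, (0 : ℝ))) := by
    refine (tendsto_integral_of_dominated_convergence b
      (fun i => ((hk i).1.sub hl).abs.aestronglyMeasurable) hb
      (fun i => ae_of_all _ fun y => ?_) (ae_of_all _ fun y => ?_)).const_mul C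
    · simpa using hkb i y
    · have := ((h y).sub (tendsto_const_nhds (x := l y))).abs
      simpa using this
  simp only [integral_zero, mul_zero] at h1
  obtain ⟨i, hi⟩ := (h1.eventually_le_const hε).exists
  refine ⟨_, (hk i).2, fun n => ?_⟩
  refine le_trans ?_ hi
  rw [← integral_sub (integrable_shift_mul hg hC hl _) (integrable_shift_mul hg hC (hk i).1 _),
    ← integral_const_mul]
  refine norm_integral_le_of_norm_le (((hk i).1.sub hl).abs.const_mul C) (ae_of_all _ fun y => ?_)
  rw [← mul_sub, norm_mul, ← Complex.ofReal_sub, Complex.norm_real, Real.norm_eq_abs, abs_sub_comm]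
  exact mul_le_mul_of_nonneg_right (hC _) (abs_nonneg _)

theorem integrable_pow_mul_exp_neg_mul_sq (m : ℕ) {w : ℝ} (hw : 0 < w) :
    Integrable fun y : ℝ => (y ^ 2) ^ m * Real.exp (-w * y ^ 2) := by
  have h := integrable_rpow_mul_exp_neg_mul_sq hw (s := ((2 * m : ℕ) : ℝ))
    (by have : (0 : ℝ) ≤ ((2 * m : ℕ) : ℝ) := Nat.cast_nonneg _
        linarith)
  simpa only [Real.rpow_natCast, pow_mul] using h

theorem gaussianPDFReal_zero_eq {w : ℝ} (hw : 0 < w) {v : NNReal} (hv : (v : ℝ) = (2 * w)⁻¹)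
    (y : ℝ) : ProbabilityTheory.gaussianPDFReal 0 v y =
      (Real.sqrt (2 * Real.pi * v))⁻¹ * Real.exp (-w * y ^ 2) := by
  rw [ProbabilityTheory.gaussianPDFReal, hv, sub_zero]
  congr 2
  field_simp

theorem exp_mem_admissibleKernels_of_lt_two (hg : Measurable g) (hC : ∀ x, ‖g x‖ ≤ C) {w : ℝ}
    (hw : 0 < w) (hw2 : w < 2) : (fun y => Real.exp (-w * y ^ 2)) ∈ admissibleKernels g := by
  -- exp(-wy²) has variance 1/(2w), which exceeds 1/4 exactly when w < 2.
  have hu : 0 ≤ (2 * w)⁻¹ - 1 / 4 := by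
    rw [sub_nonneg, ← one_div]
    exact one_div_le_one_div_of_le (by positivity) (by linarith)
  obtain ⟨u, hu'⟩ : ∃ u : NNReal, (u : ℝ) = (2 * w)⁻¹ - 1 / 4 := ⟨⟨_, hu⟩, rfl⟩
  have hv : ((1 / 4 + u : NNReal) : ℝ) = (2 * w)⁻¹ := by
    push_cast
    rw [hu']
    ring
  have hv0 : (1 / 4 + u : NNReal) ≠ 0 := by positivity
  have hp : 0 < Real.sqrt (2 * Real.pi * (1 / 4 + u : NNReal)) := by
    rw [hv]
    positivity
  have hmem : (fun y => ProbabilityTheory.gaussianPDFReal 0 (1 / 4 + u) y)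
      ∈ admissibleKernels g := by
    refine ⟨ProbabilityTheory.integrable_gaussianPDFReal _ _, ?_⟩
    convert integral_gaussianReal_mem_eigenClosureFun hg hC u using 1
    ext n
    rw [ProbabilityTheory.integral_gaussianReal_eq_integral_smul hv0]
    simp only [Complex.real_smul, mul_comm]
  convert const_mul_mem_admissibleKernels hmem
    (Real.sqrt (2 * Real.pi * (1 / 4 + u : NNReal))) using 2 with y
  rw [gaussianPDFReal_zero_eq hw hv, mul_inv_cancel_left₀ hp.ne']

/-- Each further factor y² is minus a derivative in w, obtained as an L¹ limit of difference
quotients; 1 - exp(-t) ≤ t supplies the dominating function. -/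
theorem pow_mul_exp_mem_admissibleKernels (hg : Measurable g) (hC : ∀ x, ‖g x‖ ≤ C) {W : ℝ}
    (h : ∀ w, 0 < w → w < W → (fun y => Real.exp (-w * y ^ 2)) ∈ admissibleKernels g) (m : ℕ) :
    ∀ w, 0 < w → w < W →
      (fun y => (y ^ 2) ^ m * Real.exp (-w * y ^ 2)) ∈ admissibleKernels g := by
  induction m with
  | zero => simpa using h
  | succ m ih =>
    intro w hw hwW
    -- The denominator i + 2 keeps w + d i below W already for i = 0.
    set d : ℕ → ℝ := fun i => (W - w) / (i + 2) with hd
    have hdpos : ∀ i, 0 < d i := fun i => div_pos (by linarith) (by positivity)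
    have hdlt : ∀ i, d i < W - w := fun i => by
      have h1 : (0 : ℝ) ≤ i := i.cast_nonneg
      rw [hd, div_lt_iff₀ (by positivity)]
      nlinarith
    have hd0 : Tendsto d atTop (𝓝 0) :=
      tendsto_const_nhds.div_atTop
        (tendsto_atTop_add_const_right _ _ tendsto_natCast_atTop_atTop)
    have key : ∀ i (y : ℝ), (d i)⁻¹ * ((y ^ 2) ^ m * Real.exp (-w * y ^ 2)) +
        -(d i)⁻¹ * ((y ^ 2) ^ m * Real.exp (-(w + d i) * y ^ 2)) =
        (y ^ 2) ^ m * Real.exp (-w * y ^ 2) * ((1 - Real.exp (-(d i * y ^ 2))) / d i) := by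
      intro i y
      have h2 : -(w + d i) * y ^ 2 = -w * y ^ 2 + -(d i * y ^ 2) := by ring
      rw [h2, Real.exp_add]
      ring
    refine mem_admissibleKernels_of_tendsto hg hC
      (k := fun i y => (d i)⁻¹ * ((y ^ 2) ^ m * Real.exp (-w * y ^ 2)) +
        -(d i)⁻¹ * ((y ^ 2) ^ m * Real.exp (-(w + d i) * y ^ 2)))
      (fun i => add_mem_admissibleKernels hg hC (const_mul_mem_admissibleKernels (ih w hw hwW) _)
        (const_mul_mem_admissibleKernels
          (ih _ (by linarith [hdpos i]) (by linarith [hdlt i])) _))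
      (integrable_pow_mul_exp_neg_mul_sq (m + 1) hw) (integrable_pow_mul_exp_neg_mul_sq (m + 1) hw)
      (fun i y => ?_) (fun y => ?_)
    · rw [key]
      have h3 := Real.add_one_le_exp (-(d i * y ^ 2))
      have h4 : Real.exp (-(d i * y ^ 2)) ≤ 1 := by
        rw [Real.exp_le_one_iff]
        nlinarith [mul_nonneg (hdpos i).le (sq_nonneg y)]
      have h5 : (1 - Real.exp (-(d i * y ^ 2))) / d i ≤ y ^ 2 := by
        rw [div_le_iff₀ (hdpos i)]
        linarith
      have h6 : 0 ≤ (1 - Real.exp (-(d i * y ^ 2))) / d i :=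
        div_nonneg (by linarith) (hdpos i).le
      have h7 : 0 ≤ (y ^ 2) ^ m * Real.exp (-w * y ^ 2) := by positivity
      have h8 : (y ^ 2) ^ (m + 1) * Real.exp (-w * y ^ 2) =
          (y ^ 2) ^ m * Real.exp (-w * y ^ 2) * y ^ 2 := by ring
      rw [h8, ← mul_sub, abs_mul, abs_of_nonneg h7]
      refine mul_le_mul_of_nonneg_left ?_ h7
      rw [abs_le]
      constructor <;> linarith
    · simp_rw [key]
      have h2 : HasDerivAt (fun t : ℝ => 1 - Real.exp (-(t * y ^ 2))) (y ^ 2) 0 := by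
        have := (((hasDerivAt_id (0 : ℝ)).mul_const (y ^ 2)).neg.exp).const_sub 1
        simpa using this
      have h3 := (hasDerivAt_iff_tendsto_slope_zero.1 h2).comp
        (tendsto_nhdsWithin_of_tendsto_nhds_of_eventually_within _ hd0
          (Eventually.of_forall fun i => (hdpos i).ne'))
      have h4 := h3.const_mul ((y ^ 2) ^ m * Real.exp (-w * y ^ 2))
      have h5 : (y ^ 2) ^ (m + 1) * Real.exp (-w * y ^ 2) =
          (y ^ 2) ^ m * Real.exp (-w * y ^ 2) * y ^ 2 := by ring
      rw [h5]
      refine h4.congr fun i => ?_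
      simp [div_eq_inv_mul]

/-- Expand exp(-wy²) as a power series in (w₀ - w)y² times exp(-w₀y²). For w ≥ w₀ the absolute
values sum to exp(-(2w₀ - w)y²), which is integrable when w < 2w₀; this is why one pass can double
the range. -/
theorem exp_mem_admissibleKernels_of_lt_two_mul (hg : Measurable g) (hC : ∀ x, ‖g x‖ ≤ C) {W : ℝ}
    (h : ∀ w, 0 < w → w < W → (fun y => Real.exp (-w * y ^ 2)) ∈ admissibleKernels g) {w : ℝ}
    (hw : 0 < w) (hw2 : w < 2 * W) : (fun y => Real.exp (-w * y ^ 2)) ∈ admissibleKernels g := by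
  by_cases hwW : w < W
  · exact h w hw hwW
  -- The midpoint of w/2 and W: below W, so the terms are admissible, and above w/2, so the series
  -- is dominated.
  set w₀ := (w / 2 + W) / 2 with hw₀
  have h1 : w₀ < W := by linarith
  have h2 : 0 < w₀ := by linarith
  have h3 : 0 < 2 * w₀ - w := by linarith
  have h4 : w₀ ≤ w := by linarith
  have hsum : ∀ y : ℝ, HasSum (fun m : ℕ => (w₀ - w) ^ m / m.factorial *
      ((y ^ 2) ^ m * Real.exp (-w₀ * y ^ 2))) (Real.exp (-w * y ^ 2)) := by
    intro y
    have h5 := (NormedSpace.expSeries_div_hasSum_exp ((w₀ - w) * y ^ 2)).mul_right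
      (Real.exp (-w₀ * y ^ 2))
    rw [← Real.exp_eq_exp_ℝ, ← Real.exp_add] at h5
    have hv : -w * y ^ 2 = (w₀ - w) * y ^ 2 + -w₀ * y ^ 2 := by ring
    rw [hv]
    refine Eq.mp (congrArg (fun f => HasSum f _) (funext fun m => ?_)) h5
    rw [mul_pow]
    ring
  have habs : ∀ y : ℝ, HasSum (fun m : ℕ => |(w₀ - w) ^ m / m.factorial *
      ((y ^ 2) ^ m * Real.exp (-w₀ * y ^ 2))|) (Real.exp (-(2 * w₀ - w) * y ^ 2)) := by
    intro y
    have h5 := (NormedSpace.expSeries_div_hasSum_exp ((w - w₀) * y ^ 2)).mul_right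
      (Real.exp (-w₀ * y ^ 2))
    rw [← Real.exp_eq_exp_ℝ, ← Real.exp_add] at h5
    have hv : -(2 * w₀ - w) * y ^ 2 = (w - w₀) * y ^ 2 + -w₀ * y ^ 2 := by ring
    rw [hv]
    refine Eq.mp (congrArg (fun f => HasSum f _) (funext fun m => ?_)) h5
    have h6 : |w₀ - w| = w - w₀ := by rw [abs_of_nonpos (by linarith)]; ring
    rw [abs_mul, abs_div, abs_pow, h6, abs_of_nonneg (by positivity : (0 : ℝ) ≤ m.factorial),
      abs_of_nonneg (by positivity : 0 ≤ (y ^ 2) ^ m * Real.exp (-w₀ * y ^ 2)), mul_pow]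
    ring
  refine mem_admissibleKernels_of_tendsto hg hC
    (k := fun N y => ∑ m ∈ Finset.range N, (w₀ - w) ^ m / m.factorial *
      ((y ^ 2) ^ m * Real.exp (-w₀ * y ^ 2)))
    (sum_mem_admissibleKernels hg hC fun m => const_mul_mem_admissibleKernels
      (pow_mul_exp_mem_admissibleKernels hg hC h m w₀ h2 h1) _)
    (integrable_exp_neg_mul_sq hw)
    ((integrable_exp_neg_mul_sq h3).add (integrable_exp_neg_mul_sq hw)) (fun N y => ?_)
    fun y => (hsum y).tendsto_sum_nat
  refine (abs_sub _ _).trans (add_le_add ?_ (abs_of_pos (Real.exp_pos _)).le)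
  exact (Finset.abs_sum_le_sum_abs _ _).trans
    (sum_le_hasSum _ (fun _ _ => abs_nonneg _) (habs y))

theorem exp_mem_admissibleKernels (hg : Measurable g) (hC : ∀ x, ‖g x‖ ≤ C) {w : ℝ}
    (hw : 0 < w) : (fun y => Real.exp (-w * y ^ 2)) ∈ admissibleKernels g := by
  have h : ∀ N : ℕ, ∀ w, 0 < w → w < 2 ^ N * 2 →
      (fun y => Real.exp (-w * y ^ 2)) ∈ admissibleKernels g := by
    intro N
    induction N with
    | zero => exact fun w h0 h2 => exp_mem_admissibleKernels_of_lt_two hg hC h0 (by linarith)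
    | succ N ih =>
      exact fun w h0 h2 => exp_mem_admissibleKernels_of_lt_two_mul hg hC ih h0
        (by rw [pow_succ] at h2; linarith)
  obtain ⟨N, hN⟩ := pow_unbounded_of_one_lt w (one_lt_two (α := ℝ))
  exact h N w hw (by linarith)

theorem integral_gaussianReal_mem_eigenClosureFun_of_pos (hg : Measurable g) (hC : ∀ x, ‖g x‖ ≤ C)
    {v : NNReal} (hv : 0 < v) :
    (fun n : ℕ => ∫ y, g (Real.sqrt n + y) ∂ProbabilityTheory.gaussianReal 0 v)
      ∈ eigenClosureFun := by
  have hv0 : (0 : ℝ) < v := hv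
  have h1 := (const_mul_mem_admissibleKernels
    (exp_mem_admissibleKernels hg hC (w := (2 * (v : ℝ))⁻¹) (by positivity))
    (Real.sqrt (2 * Real.pi * v))⁻¹).2
  convert h1 using 1
  ext n
  rw [ProbabilityTheory.integral_gaussianReal_eq_integral_smul hv.ne']
  refine integral_congr_ae (ae_of_all _ fun y => ?_)
  simp only
  rw [gaussianPDFReal_zero_eq (w := (2 * (v : ℝ))⁻¹) (by positivity) (by field_simp),
    Complex.real_smul, mul_comm]

end Kernels

/-! ### Approximation of sequences in RO -/

open ProbabilityTheory in
theorem integral_sq_gaussianReal_zero (v : NNReal) : ∫ y, y ^ 2 ∂gaussianReal 0 v = v := by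
  have h := variance_eq_sub (memLp_id_gaussianReal' (μ := 0) (v := v) 2 (by simp))
  rw [variance_id_gaussianReal] at h
  simpa [integral_id_gaussianReal] using h.symm

/-- For x = √n + y and M = ⌊x²⌋, x² - M < 1 makes x - √M at most 1/x ≤ δ/2; the shift y costs
another δ/2. The lower bound on √n ensures x ≥ 2/δ. -/
theorem sqrtDist_floor_sq_le {δ : ℝ} (hδ : 0 < δ) {n : ℕ} (hn : δ / 2 + 2 / δ ≤ Real.sqrt n)
    {y : ℝ} (hy : |y| ≤ δ / 2) : sqrtDist n ⌊(Real.sqrt n + y) ^ 2⌋₊ ≤ δ := by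
  set x := Real.sqrt n + y with hx
  obtain ⟨hy1, hy2⟩ := abs_le.1 hy
  have hx1 : 2 / δ ≤ x := by linarith
  have hx0 : 0 < x := lt_of_lt_of_le (by positivity) hx1
  set M := ⌊x ^ 2⌋₊ with hM
  have h1 : (M : ℝ) ≤ x ^ 2 := Nat.floor_le (by positivity)
  have h2 : x ^ 2 < M + 1 := Nat.lt_floor_add_one _
  have h3 : Real.sqrt M ^ 2 = M := Real.sq_sqrt M.cast_nonneg
  have h4 : Real.sqrt M ≤ x := Real.sqrt_le_iff.2 ⟨hx0.le, h1⟩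
  have h5 : x - Real.sqrt M ≤ δ / 2 := by
    have h6 : (2 / δ) * (x - Real.sqrt M) ≤ 1 := by
      nlinarith [Real.sqrt_nonneg (M : ℝ)]
    rw [div_mul_eq_mul_div, div_le_one hδ] at h6
    linarith
  rw [sqrtDist, abs_le]
  constructor <;> linarith

theorem coe_mem_eigenClosureFun_of_mem_RO {σ : LinftySeq} (hσ : σ ∈ RO) :
    ⇑σ ∈ eigenClosureFun := by
  refine mem_eigenClosureFun_of_eventually_approx fun ε hε => ?_
  obtain ⟨δ, hδ, h⟩ := (mem_RO_iff σ).1 hσ (ε / 2) (by positivity)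
  set g : ℝ → ℂ := fun x => σ ⌊x ^ 2⌋₊ with hgdef
  have hg : Measurable g :=
    (measurable_from_nat (f := ⇑σ)).comp (Nat.measurable_floor.comp (measurable_id.pow_const 2))
  have hC : ∀ x, ‖g x‖ ≤ ‖σ‖ := fun x => lp.norm_apply_le_norm (by simp) σ _
  -- A Chebyshev constant: for |y| > δ/2, c·y² exceeds the trivial bound 2‖σ‖. The variance v is
  -- then chosen so that the mean of c·y² is at most ε/2.
  set c : ℝ := 2 * ‖σ‖ / (δ / 2) ^ 2 with hc
  have hc0 : 0 ≤ c := by positivity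
  obtain ⟨v, hv0, hv⟩ : ∃ v : NNReal, 0 < v ∧ c * v ≤ ε / 2 := by
    have hp : 0 < ε / 2 / (c + 1) := by positivity
    refine ⟨(ε / 2 / (c + 1)).toNNReal, Real.toNNReal_pos.2 hp, ?_⟩
    rw [Real.coe_toNNReal _ hp.le, mul_div_assoc', div_le_iff₀ (by positivity)]
    nlinarith
  refine ⟨_, integral_gaussianReal_mem_eigenClosureFun_of_pos hg hC hv0, ?_⟩
  have hs : Tendsto (fun n : ℕ => Real.sqrt n) atTop atTop :=
    Real.tendsto_sqrt_atTop.comp tendsto_natCast_atTop_atTop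
  filter_upwards [hs.eventually_ge_atTop (δ / 2 + 2 / δ)] with n hn
  have hbound : ∀ y : ℝ, ‖σ n - g (Real.sqrt n + y)‖ ≤ ε / 2 + c * y ^ 2 := by
    intro y
    rcases le_or_gt |y| (δ / 2) with hy | hy
    · have h1 := h n _ (sqrtDist_floor_sq_le hδ hn hy)
      rw [norm_sub_rev] at h1
      have h2 : 0 ≤ c * y ^ 2 := by positivity
      exact h1.trans (by linarith)
    · have h1 : (δ / 2) ^ 2 ≤ y ^ 2 := by
        rw [← sq_abs y]
        gcongr
      have h2 : 2 * ‖σ‖ ≤ c * y ^ 2 := by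
        rw [hc, div_mul_eq_mul_div, le_div_iff₀ (by positivity)]
        gcongr
      have h3 := norm_sub_le (σ n) (g (Real.sqrt n + y))
      have h4 : ‖σ n‖ ≤ ‖σ‖ := lp.norm_apply_le_norm (by simp) σ n
      linarith [hC (Real.sqrt n + y)]
  have hi : Integrable (fun y => g (Real.sqrt n + y)) (ProbabilityTheory.gaussianReal 0 v) :=
    Integrable.of_bound (hg.comp (measurable_const_add _)).aestronglyMeasurable ‖σ‖
      (ae_of_all _ fun _ => hC _)
  have hsq : Integrable (fun y : ℝ => c * y ^ 2) (ProbabilityTheory.gaussianReal 0 v) :=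
    (ProbabilityTheory.memLp_id_gaussianReal' 2 (by simp)).integrable_sq.const_mul c
  have h1 : σ n - ∫ y, g (Real.sqrt n + y) ∂ProbabilityTheory.gaussianReal 0 v =
      ∫ y, (σ n - g (Real.sqrt n + y)) ∂ProbabilityTheory.gaussianReal 0 v := by
    rw [integral_sub (integrable_const _) hi]
    simp
  rw [h1]
  refine (norm_integral_le_of_norm_le ((integrable_const (ε / 2)).add hsq)
    (ae_of_all _ hbound)).trans ?_
  rw [integral_add' (integrable_const _) hsq, integral_const_mul, integral_sq_gaussianReal_zero]
  simp only [integral_const, probReal_univ, one_smul]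
  linarith

theorem closure_eigenSequences : closure eigenSequences = (RO : Set LinftySeq) := by
  refine Set.Subset.antisymm (closure_minimal eigenSequences_subset_RO isClosed_RO) fun σ hσ => ?_
  rw [← coe_eigenClosure, SetLike.mem_coe, ← coe_mem_eigenClosureFun]
  exact coe_mem_eigenClosureFun_of_mem_RO hσ

/-- The closure of 𝔊 is already the C*-algebra RO, so generating an algebra adds nothing. -/
theorem eigenAlgebra_eq_RO : eigenAlgebra = RO := by
  refine le_antisymm (StarSubalgebra.topologicalClosure_minimal
    (StarAlgebra.adjoin_le eigenSequences_subset_RO) isClosed_RO) ?_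
  rw [← SetLike.coe_subset_coe, ← closure_eigenSequences]
  exact closure_mono (StarAlgebra.subset_adjoin ℂ eigenSequences)

end RadialFock

end

theorem mainTheorem1 :
    -- `γ_a` is the eigenvalue sequence of the radial Toeplitz operator with profile `a`
    (∀ (a : RadialFock.LinftyPos) (φ : RadialFock.LinftyC), RadialFock.HasRadialProfile φ a →
      ∀ n : ℕ, RadialFock.toeplitz φ (RadialFock.monomial n)
        = RadialFock.gammaSeq a n • RadialFock.monomial n) ∧
    -- `𝔊 ⊆ RO(ℤ₊)`, and `𝔊` is uniformly dense in `RO(ℤ₊)`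
    RadialFock.eigenSequences ⊆ (RadialFock.RO : Set RadialFock.LinftySeq) ∧
    (∀ σ ∈ RadialFock.RO, ∀ ε : ℝ, 0 < ε →
      ∃ a : RadialFock.LinftyPos, ‖σ - RadialFock.gammaSeq a‖ ≤ ε) ∧
    -- the uniform closure of `𝔊`, and the C*-algebra generated by `𝔊`, are `RO(ℤ₊)`
    closure RadialFock.eigenSequences = (RadialFock.RO : Set RadialFock.LinftySeq) ∧
    RadialFock.eigenAlgebra = RadialFock.RO ∧
    -- the C*-algebra generated by the radial Toeplitz operators is isometrically *-isomorphic
    -- to `RO(ℤ₊)`, an operator being sent to its sequence of eigenvalues on the monomials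
    ∃ Φ : RadialFock.radialToeplitzAlgebra ≃⋆ₐ[ℂ] RadialFock.RO, Isometry Φ ∧
      ∀ (S : RadialFock.radialToeplitzAlgebra) (n : ℕ),
        (S : RadialFock.FockSpace →L[ℂ] RadialFock.FockSpace) (RadialFock.monomial n)
          = (Φ S : RadialFock.LinftySeq) n • RadialFock.monomial n := by
  refine ⟨fun a φ h n => RadialFock.toeplitz_monomial h n, RadialFock.eigenSequences_subset_RO,
    fun σ hσ ε hε => ?_, RadialFock.closure_eigenSequences, RadialFock.eigenAlgebra_eq_RO, ?_⟩
  · have h : σ ∈ closure RadialFock.eigenSequences := by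
      rw [RadialFock.closure_eigenSequences]
      exact hσ
    obtain ⟨_, ⟨a, rfl⟩, ha⟩ := Metric.mem_closure_iff.1 h ε hε
    exact ⟨a, by rw [← dist_eq_norm]; exact ha.le⟩
  · refine RadialFock.exists_starAlgEquiv_of_map ?_
    rw [RadialFock.radialToeplitzAlgebra_eq_map, RadialFock.eigenAlgebra_eq_RO]
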